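/- **The game.** In the symmetric rendezvous search game on $K_4$ two players are placed at two distinct vertices (their homes). At each step $1,2,3,\dots$ each player stays where he is or moves to any other vertex, and the game ends at the first step $T$ after which both are at the same vertex. The players share no labelling of the vertices: each has a private labelling in which his own home has a distinguished label, and the labels of the three other vertices are assigned uniformly at random, independently for the two players. Both players use the same randomized strategy (a probability law on sequences of private labels), independently of each other, and $ET$ denotes the resulting expected meeting time. A strategy is $k$-Markov if it proceeds in successive blocks of $k$ steps, the behaviour in the blocks being independent and identically distributed. A *tour* is an ordering of a player's three non-home vertices, visited in three consecutive steps. **The Anderson–Weber strategy** $\mathrm{AW}(p)$, $p\in[0,1]$, is the $3$-Markov strategy which in each block of $3$ steps stays home with probability $p$ and otherwise makes a uniformly random tour. **The new strategy** $S(p)$, $p\in[0,1]$, works in blocks of $12$ steps, each consisting of four $3$-step "t-steps". In each t-step, independently, the player stays home with probability $p$ and tours with probability $1-p$. The $j$-th tour made within a block ($j\le 4$) is the $j$-th entry of a random quadruple of tours drawn for that block, independently of the decisions to stay or tour: the quadruple has pattern $AAAB$, $AABA$, $ABAA$, $ABBB$ with probability $\tfrac1{12}$ each and pattern $ABCD$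 with probability $\tfrac23$, where distinct letters stand for distinct tours, chosen uniformly at random. After 12 steps the strategy restarts afresh. **Theorem.** Whatever the two distinct homes are: 1. For every $p\in[0,1]$, $S(p)$ is a $12$-Markov strategy, and for $0\le p<1$ its expected meeting time is $$ET_{S(p)}=\frac{-227773 p^8+582884 p^7-1329319 p^6+1737938 p^5-1941235 p^4+1420688 p^3-998569 p^2+389834 p-217648}{3\left(82001 p^8-218608 p^7+327728 p^6-315256 p^5+215870 p^4-104656 p^3+36128 p^2-8008 p-15199\right)}.$$ 2. For $0\le p<1$, $ET_{\mathrm{AW}(p)}=\dfrac{43-14p+25p^2}{9(1+2p-3p^2)}$. The number $p_0=\frac14(3\sqrt{681}-77)$ lies in $[0,1]$, and $\mathrm{AW}(p_0)$ has the smallest expected meeting time among all $\mathrm{AW}(p)$, $p\in[0,1]$, namely $\frac1{12}(15+\sqrt{681})$. 3. At $p=p_0$, $$ET_{\mathrm{AW}(p_0)}-ET_{S(p_0)}=\frac{243\left(75041961207+4700853101\sqrt{681}\right)}{327540887401488016}\approx 0.000146683$$ (correct to within $5\cdot 10^{-10}$). Hence $ET_{S(p_0)}<ET_{\mathrm{AW}(p)}$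 for all $p\in[0,1]$, and no Anderson–Weber strategy is optimal (that is, none minimizes $ET$ over all strategies). -/

import Mathlib

open MeasureTheory
open scoped ENNReal

/-!
The symmetric rendezvous search game on the complete graph with `m + 1` locations `Fin (m + 1)`.

Each player has a private labelling of the locations by `Fin (m + 1)`, in which his own home
(his initial location) has label `0`. Since every move (including staying) is possible at every
step and a player observes nothing before the meeting, a pure strategy is a sequence
`w : ℕ → Fin (m + 1)`, where `w t` is the label of the location he occupies after his step number
`t + 1`, and a (mixed) strategy is a probability measure on such sequences.
-/

/-- The number of the first step after which the two trajectories (sequences of locations) agree;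
`∞` if they never do. -/
noncomputable def meetingTime {m : ℕ} (x y : ℕ → Fin (m + 1)) : ℝ≥0∞ :=
  ⨅ (t : ℕ) (_ : x t = y t), ((t : ℝ≥0∞) + 1)

/-- The private labellings of a player whose home is `h`: bijections from labels to locations that
send the label `0` to `h`. -/
abbrev Labelling {m : ℕ} (h : Fin (m + 1)) : Type :=
  {σ : Equiv.Perm (Fin (m + 1)) // σ 0 = h}

/-- The expected number of steps until the first meeting when the players, with homes `h₁`, `h₂`,
both use the strategy `μ`, independently of each other. There is no common labelling: the
private labellings are independent and uniformly random. -/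
noncomputable def expectedMeetingTime {m : ℕ} (h₁ h₂ : Fin (m + 1))
    (μ : Measure (ℕ → Fin (m + 1))) : ℝ≥0∞ :=
  (∑ σ₁ : Labelling h₁, ∑ σ₂ : Labelling h₂,
      ∫⁻ w, meetingTime (fun t => σ₁.1 (w.1 t)) (fun t => σ₂.1 (w.2 t)) ∂(μ.prod μ)) /
    ((Fintype.card (Labelling h₁) : ℝ≥0∞) * (Fintype.card (Labelling h₂) : ℝ≥0∞))

/-- `μ` minimizes the expected meeting time among all strategies. -/
def IsOptimal {m : ℕ} (h₁ h₂ : Fin (m + 1)) (μ : Measure (ℕ → Fin (m + 1))) : Prop :=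
  ∀ ν : Measure (ℕ → Fin (m + 1)), IsProbabilityMeasure ν →
    expectedMeetingTime h₁ h₂ μ ≤ expectedMeetingTime h₁ h₂ ν

/-- The strategy that plays in successive blocks of `k` steps, the behaviour in each block being
drawn afresh from the law `β`, independently of the other blocks. -/
noncomputable def markovStrategy {m : ℕ} (k : ℕ) [NeZero k] (β : PMF (Fin k → Fin (m + 1))) :
    Measure (ℕ → Fin (m + 1)) :=
  (Measure.infinitePi (fun _ : ℕ => β.toMeasure)).map
    (fun (B : ℕ → Fin k → Fin (m + 1)) (t : ℕ) => B (t / k) (Fin.ofNat k t))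

instance {m : ℕ} (k : ℕ) [NeZero k] (β : PMF (Fin k → Fin (m + 1))) :
    IsProbabilityMeasure (markovStrategy k β) := by
  unfold markovStrategy
  refine Measure.isProbabilityMeasure_map (Measurable.aemeasurable ?_)
  fun_prop

/-- A `k`-Markov strategy. -/
def IsMarkov {m : ℕ} (k : ℕ) [NeZero k] (μ : Measure (ℕ → Fin (m + 1))) : Prop :=
  ∃ β : PMF (Fin k → Fin (m + 1)), μ = markovStrategy k β

/-- `r` independent decisions, each of them `true` (stay home) with probability `p` and `false`
(tour) with probability `1 - p`. -/
noncomputable def stayLaw (r : ℕ) (p : unitInterval) : PMF (Fin r → Bool) :=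
  PMF.ofFintype
    (fun s => ∏ i, if s i then ENNReal.ofReal (p : ℝ) else ENNReal.ofReal (1 - (p : ℝ))) (by
      have h := Finset.prod_univ_sum (fun _ : Fin r => (Finset.univ : Finset Bool))
        (fun _ b => if b then ENNReal.ofReal (p : ℝ) else ENNReal.ofReal (1 - (p : ℝ)))
      rw [Fintype.piFinset_univ] at h
      rw [← h]
      refine Finset.prod_eq_one fun i _ => ?_
      rw [Fintype.sum_bool]
      simp only [if_true, Bool.false_eq_true, if_false]
      rw [← ENNReal.ofReal_add p.2.1 (sub_nonneg.2 p.2.2)]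
      simp)

/-- A tour of the `m` non-home locations (whose labels are the successors `Fin.succ i`, `i : Fin m`)
is an ordering `τ` of them: after step `i + 1` of the tour the player is at `(τ i).succ`. -/
abbrev Tour (m : ℕ) : Type := Equiv.Perm (Fin m)

/-- The law of one block (of `m` steps) of the Anderson–Weber strategy: stay home with probability
`p`, and make a uniformly random tour with probability `1 - p`. -/
noncomputable def awBlock (m : ℕ) (p : unitInterval) : PMF (Fin m → Fin (m + 1)) :=
  (stayLaw 1 p).bind fun s => (PMF.uniformOfFintype (Tour m)).map fun τ =>
    fun t => if s 0 then 0 else (τ t).succ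

/-- The Anderson–Weber strategy with staying probability `p` on the complete graph with `m + 1`
locations. -/
noncomputable def andersonWeber (m : ℕ) [NeZero m] (p : unitInterval) : Measure (ℕ → Fin (m + 1)) :=
  markovStrategy m (awBlock m p)

/-- The patterns `AAAB`, `AABA`, `ABAA`, `ABBB`, `ABCD` of four tours, where the letters
`A, B, C, D` are `0, 1, 2, 3 : Fin 4`. -/
def pattern : Fin 5 → Fin 4 → Fin 4 :=
  ![![0, 0, 0, 1], ![0, 0, 1, 0], ![0, 1, 0, 0], ![0, 1, 1, 1], ![0, 1, 2, 3]]

/-- The pattern is `AAAB`, `AABA`, `ABAA`, `ABBB` with probability `1/12` each and `ABCD` with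
probability `2/3`. -/
noncomputable def patternLaw : PMF (Fin 5) :=
  PMF.ofFintype ![1 / 12, 1 / 12, 1 / 12, 1 / 12, 2 / 3] (by
    have h1 : (1 / 12 : ℝ≥0∞) = ENNReal.ofReal (1 / 12) := by
      rw [ENNReal.ofReal_div_of_pos (by norm_num)]; simp
    have h2 : (2 / 3 : ℝ≥0∞) = ENNReal.ofReal (2 / 3) := by
      rw [ENNReal.ofReal_div_of_pos (by norm_num)]; simp
    rw [Fin.sum_univ_five]
    simp only [Matrix.cons_val]
    rw [h1, h2, ← ENNReal.ofReal_add, ← ENNReal.ofReal_add, ← ENNReal.ofReal_add,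
      ← ENNReal.ofReal_add] <;> norm_num)

instance : Nonempty (Fin 4 ↪ Tour 3) :=
  Function.Embedding.nonempty_of_card_le (by simp [Fintype.card_perm, Nat.factorial])

/-- The law of four correlated tours on `K₄`: a pattern is drawn from `patternLaw`, and its letters
stand for distinct tours chosen uniformly at random. -/
noncomputable def fourToursLaw : PMF (Fin 4 → Tour 3) :=
  patternLaw.bind fun q => (PMF.uniformOfFintype (Fin 4 ↪ Tour 3)).map fun e =>
    fun j => e (pattern q j)

/-- The number of tours made before the t-step `i`, when `s` lists the t-steps spent at home. -/
def toursBefore (s : Fin 4 → Bool) (i : Fin 4) : Fin 4 :=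
  ⟨(Finset.univ.filter fun j => j < i ∧ s j = false).card, by
    calc (Finset.univ.filter fun j => j < i ∧ s j = false).card
        ≤ (Finset.Iio i).card := Finset.card_le_card fun j hj => by
          simpa using (Finset.mem_filter.1 hj).2.1
      _ = i := Fin.card_Iio i
      _ < 4 := i.2⟩

/-- The law of one block of `12` steps, i.e. of `4` t-steps of `3` steps each, of the improved
strategy on `K₄`: in every t-step, independently, the player stays home with probability `p` and
tours with probability `1 - p`; the first, second, … tour that he makes within the block is the
first, second, … entry of a quadruple of tours drawn from `fourToursLaw`. -/
noncomputable def improvedBlock (p : unitInterval) : PMF (Fin 12 → Fin 4) :=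
  (stayLaw 4 p).bind fun s => fourToursLaw.map fun τ => fun t =>
    let i : Fin 4 := Fin.ofNat 4 (t / 3)
    if s i then 0 else (τ (toursBefore s i) (Fin.ofNat 3 t)).succ

/-- The improved strategy on `K₄`. -/
noncomputable def improvedStrategy (p : unitInterval) : Measure (ℕ → Fin 4) :=
  markovStrategy (m := 3) 12 (improvedBlock p)

/-- The indicator, with values in a semiring, of two points being distinct. -/
def apart {α R : Type*} [DecidableEq α] [Zero R] [One R] (x y : α) : R := if x = y then 0 else 1

lemma meetingTime_eq_tsum {m : ℕ} (x y : ℕ → Fin (m + 1)) :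
    meetingTime x y = ∑' n, ∏ t ∈ Finset.range n, apart (x t) (y t) := by
  unfold meetingTime apart
  by_cases h : ∃ t, x t = y t
  · classical
    have h1 : ∀ t < Nat.find h, x t ≠ y t := fun t ht => Nat.find_min h ht
    have h2 : x (Nat.find h) = y (Nat.find h) := Nat.find_spec h
    rw [tsum_eq_sum (s := Finset.range (Nat.find h + 1))]
    · rw [Finset.sum_congr rfl (g := fun _ => 1)]
      · simp only [Finset.sum_const, Finset.card_range, nsmul_eq_mul, mul_one]
        push_cast
        apply le_antisymm
        · exact iInf₂_le (f := fun t (_ : x t = y t) => (t : ℝ≥0∞) + 1) _ h2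
        · refine le_iInf₂ fun t ht => ?_
          gcongr
          exact_mod_cast Nat.find_min' h ht
      · intro n hn
        refine Finset.prod_eq_one fun t ht => if_neg (h1 t ?_)
        simp only [Finset.mem_range] at hn ht
        omega
    · intro n hn
      refine Finset.prod_eq_zero (i := Nat.find h) ?_ (if_pos h2)
      simp only [Finset.mem_range] at hn ⊢
      omega
  · push Not at h
    simp [h]

/-- Expectation with respect to a probability mass function. -/
noncomputable def PMF.lexp {α : Type*} (β : PMF α) (f : α → ℝ≥0∞) : ℝ≥0∞ := ∑' a, β a * f a

namespace PMF

variable {α γ : Type*}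

lemma lexp_bind (β : PMF α) (κ : α → PMF γ) (f : γ → ℝ≥0∞) :
    (β.bind κ).lexp f = β.lexp fun a => (κ a).lexp f := by
  simp only [lexp, PMF.bind_apply, ← ENNReal.tsum_mul_right, ← ENNReal.tsum_mul_left]
  rw [ENNReal.tsum_comm]
  simp only [mul_assoc]

lemma lexp_pure (a : α) (f : α → ℝ≥0∞) : (PMF.pure a).lexp f = f a := by
  rw [lexp, tsum_eq_single a] <;> simp +contextual [PMF.pure_apply]

lemma lexp_map (β : PMF α) (g : α → γ) (f : γ → ℝ≥0∞) :
    (β.map g).lexp f = β.lexp (f ∘ g) := by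
  rw [← PMF.bind_pure_comp, lexp_bind]
  simp [Function.comp_def, lexp_pure]

lemma lexp_eq_sum [Fintype α] (β : PMF α) (f : α → ℝ≥0∞) : β.lexp f = ∑ a, β a * f a :=
  tsum_fintype _

lemma lexp_add (β : PMF α) (f g : α → ℝ≥0∞) :
    (β.lexp fun a => f a + g a) = β.lexp f + β.lexp g := by
  simp [lexp, mul_add, ENNReal.tsum_add]

lemma lexp_sum {ι : Type*} (s : Finset ι) (β : PMF α) (f : ι → α → ℝ≥0∞) :
    (β.lexp fun a => ∑ i ∈ s, f i a) = ∑ i ∈ s, β.lexp (f i) := by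
  simp only [lexp, Finset.mul_sum]
  exact Summable.tsum_finsetSum fun i _ => ENNReal.summable

lemma lexp_const_mul (β : PMF α) (c : ℝ≥0∞) (f : α → ℝ≥0∞) :
    (β.lexp fun a => c * f a) = c * β.lexp f := by
  simp [lexp, mul_left_comm _ c, ENNReal.tsum_mul_left]

lemma lexp_const (β : PMF α) (c : ℝ≥0∞) : (β.lexp fun _ => c) = c := by
  simp [lexp, ENNReal.tsum_mul_right, β.tsum_coe]

lemma lexp_comm (β : PMF α) (β' : PMF γ) (f : α → γ → ℝ≥0∞) :
    (β.lexp fun a => β'.lexp fun b => f a b) = β'.lexp fun b => β.lexp fun a => f a b := by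
  simp only [lexp, ← ENNReal.tsum_mul_left]
  rw [ENNReal.tsum_comm]
  simp only [mul_left_comm]

lemma lintegral_eq_lexp [Countable α] [MeasurableSpace α] [MeasurableSingletonClass α] (β : PMF α)
    (f : α → ℝ≥0∞) : ∫⁻ a, f a ∂β.toMeasure = β.lexp f := by
  rw [lintegral_countable', lexp]
  refine tsum_congr fun a => ?_
  rw [β.toMeasure_apply_singleton a (measurableSet_singleton a), mul_comm]

end PMF

lemma lintegral_finsetProd_infinitePi {α : Type*} [Finite α] [MeasurableSpace α]
    [MeasurableSingletonClass α] (β : PMF α) (n : ℕ) (f : ℕ → α → ℝ≥0∞) :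
    ∫⁻ B, ∏ i ∈ Finset.range n, f i (B i) ∂Measure.infinitePi (fun _ : ℕ => β.toMeasure) =
      ∏ i ∈ Finset.range n, β.lexp (f i) := by
  have hm : ∀ i, Measurable (f i) := fun i => measurable_of_finite _
  have := ProbabilityTheory.iIndepFun_infinitePi (P := fun _ : ℕ => β.toMeasure) hm
  rw [ProbabilityTheory.lintegral_prod_eq_prod_lintegral_of_indepFun _ _ this
    (fun i => (hm i).comp (measurable_pi_apply i))]
  refine Finset.prod_congr rfl fun i _ => ?_
  rw [← PMF.lintegral_eq_lexp]
  conv_rhs => rw [← Measure.infinitePi_map_eval (fun _ : ℕ => β.toMeasure) i]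
  rw [lintegral_map (hm i) (measurable_pi_apply i)]

lemma lintegral_finsetProd_infinitePi_prod {α : Type*} [Finite α] [MeasurableSpace α]
    [MeasurableSingletonClass α] (β : PMF α) (n : ℕ) (f : ℕ → α → α → ℝ≥0∞) :
    ∫⁻ B, ∏ i ∈ Finset.range n, f i (B.1 i) (B.2 i)
        ∂(Measure.infinitePi (fun _ : ℕ => β.toMeasure)).prod
          (Measure.infinitePi (fun _ : ℕ => β.toMeasure)) =
      ∏ i ∈ Finset.range n, β.lexp fun a => β.lexp fun b => f i a b := by
  rw [lintegral_prod]
  · simp only [lintegral_finsetProd_infinitePi β n (fun i => f i _)]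
    exact lintegral_finsetProd_infinitePi β n (fun i a => β.lexp (f i a))
  · refine (Finset.measurable_prod _ fun i _ => ?_).aemeasurable
    have : Measurable fun z : α × α => f i z.1 z.2 := measurable_of_finite _
    exact this.comp (by fun_prop : Measurable fun B : (ℕ → α) × (ℕ → α) => (B.1 i, B.2 i))

@[to_additive Finset.sum_range_mul_add]
lemma Finset.prod_range_mul_add {M : Type*} [CommMonoid M] (f : ℕ → M) (k b j : ℕ) :
    ∏ t ∈ range (k * b + j), f t =
      (∏ i ∈ range b, ∏ t ∈ range k, f (k * i + t)) * ∏ t ∈ range j, f (k * b + t) := by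
  rw [prod_range_add]
  congr 1
  induction b with
  | zero => simp
  | succ b ih => rw [Nat.mul_succ, prod_range_add, ih, prod_range_succ]

/-- The probability that the players, with labellings `ρ₁` and `ρ₂`, do not meet during the first
`n` steps of a block. -/
noncomputable def blockSurvival {m : ℕ} (k : ℕ) [NeZero k] (β : PMF (Fin k → Fin (m + 1)))
    (ρ₁ ρ₂ : Equiv.Perm (Fin (m + 1))) (n : ℕ) : ℝ≥0∞ :=
  β.lexp fun w => β.lexp fun w' =>
    ∏ t ∈ Finset.range n, apart (ρ₁ (w (Fin.ofNat k t))) (ρ₂ (w' (Fin.ofNat k t)))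

lemma lintegral_meetingTime_markovStrategy {m : ℕ} (k : ℕ) [NeZero k]
    (β : PMF (Fin k → Fin (m + 1))) (ρ₁ ρ₂ : Equiv.Perm (Fin (m + 1))) :
    ∫⁻ w, meetingTime (fun t => ρ₁ (w.1 t)) (fun t => ρ₂ (w.2 t))
        ∂(markovStrategy k β).prod (markovStrategy k β) =
      (∑ j ∈ Finset.range k, blockSurvival k β ρ₁ ρ₂ j) *
        (1 - blockSurvival k β ρ₁ ρ₂ k)⁻¹ := by
  have hk : 0 < k := Nat.pos_of_ne_zero (NeZero.ne k)
  simp only [meetingTime_eq_tsum]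
  have hmeas : ∀ t, Measurable fun w : (ℕ → Fin (m + 1)) × (ℕ → Fin (m + 1)) =>
      (apart (ρ₁ (w.1 t)) (ρ₂ (w.2 t)) : ℝ≥0∞) := fun t => by
    have : Measurable fun z : Fin (m + 1) × Fin (m + 1) =>
        (apart (ρ₁ z.1) (ρ₂ z.2) : ℝ≥0∞) := measurable_of_finite _
    exact this.comp (by fun_prop :
      Measurable fun w : (ℕ → Fin (m + 1)) × (ℕ → Fin (m + 1)) => (w.1 t, w.2 t))
  have hmap : Measurable
      (fun (B : ℕ → Fin k → Fin (m + 1)) (t : ℕ) => B (t / k) (Fin.ofNat k t)) := by fun_prop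
  rw [lintegral_tsum fun n => (Finset.measurable_prod _ fun t _ => hmeas t).aemeasurable]
  have key : ∀ b j, j < k →
      ∫⁻ w, ∏ t ∈ Finset.range (k * b + j), apart (ρ₁ (w.1 t)) (ρ₂ (w.2 t))
        ∂(markovStrategy k β).prod (markovStrategy k β) =
      blockSurvival k β ρ₁ ρ₂ k ^ b * blockSurvival k β ρ₁ ρ₂ j := by
    intro b j hj
    unfold markovStrategy
    rw [Measure.map_prod_map _ _ hmap hmap,
      lintegral_map (Finset.measurable_prod _ fun t _ => hmeas t) (hmap.prodMap hmap)]
    have hdiv : ∀ i t, t < k → (k * i + t) / k = i := fun i t ht => by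
      rw [Nat.mul_add_div hk, Nat.div_eq_of_lt ht, add_zero]
    have hmod : ∀ i t, Fin.ofNat k (k * i + t) = Fin.ofNat k t := fun i t => by
      ext; simp [Fin.ofNat]
    have h := lintegral_finsetProd_infinitePi_prod β (b + 1) (fun i w w' =>
      ∏ t ∈ Finset.range (if i < b then k else j),
        apart (ρ₁ (w (Fin.ofNat k t))) (ρ₂ (w' (Fin.ofNat k t))))
    rw [Finset.prod_range_succ, Finset.prod_congr rfl
      (g := fun _ => blockSurvival k β ρ₁ ρ₂ k) (fun i hi => by
        simp only [Finset.mem_range.1 hi, if_true]; rfl)] at h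
    simp only [lt_irrefl, if_false, Finset.prod_const, Finset.card_range] at h
    refine Eq.trans (lintegral_congr fun B => ?_) h
    rw [Finset.prod_range_mul_add, Finset.prod_range_succ]
    simp only [lt_irrefl, if_false]
    congr 1
    · refine Finset.prod_congr rfl fun i hi => ?_
      simp only [Finset.mem_range.1 hi, if_true]
      refine Finset.prod_congr rfl fun t ht => ?_
      simp only [Prod.map_fst, Prod.map_snd, hdiv i t (Finset.mem_range.1 ht), hmod]
    · refine Finset.prod_congr rfl fun t ht => ?_
      simp only [Prod.map_fst, Prod.map_snd, hdiv b t ((Finset.mem_range.1 ht).trans hj), hmod]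
  rw [← (Nat.divModEquiv k).symm.tsum_eq, ENNReal.tsum_prod']
  simp only [tsum_fintype]
  rw [tsum_congr (g := fun b => blockSurvival k β ρ₁ ρ₂ k ^ b *
    ∑ j ∈ Finset.range k, blockSurvival k β ρ₁ ρ₂ j)]
  · rw [ENNReal.tsum_mul_right, ENNReal.tsum_geometric, mul_comm]
  · intro b
    rw [Finset.mul_sum, ← Fin.sum_univ_eq_sum_range
      (fun j => blockSurvival k β ρ₁ ρ₂ k ^ b * blockSurvival k β ρ₁ ρ₂ j)]
    refine Finset.sum_congr rfl fun j _ => ?_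
    rw [← key b j j.2]
    simp [Nat.divModEquiv, mul_comm]

/-- The law of a block does not depend on the names of the labels of the non-home locations. -/
def RelabelInvariant {m k : ℕ} (β : PMF (Fin k → Fin (m + 1))) : Prop :=
  ∀ π : Equiv.Perm (Fin (m + 1)), π 0 = 0 → ∀ f : (Fin k → Fin (m + 1)) → ℝ≥0∞,
    (β.lexp fun w => f fun t => π (w t)) = β.lexp f

lemma apart_apply_apply {α β R : Type*} [DecidableEq α] [DecidableEq β] [Zero R] [One R]
    {g : α → β} (hg : g.Injective) (x y : α) : (apart (g x) (g y) : R) = apart x y := by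
  simp [apart, hg.eq_iff]

lemma RelabelInvariant.blockSurvival_eq {k : ℕ} [NeZero k]
    {m : ℕ} {β : PMF (Fin k → Fin (m + 2))} (hβ : RelabelInvariant β)
    {ρ₁ ρ₂ : Equiv.Perm (Fin (m + 2))} (h : ρ₁ 0 ≠ ρ₂ 0) (n : ℕ) :
    blockSurvival k β ρ₁ ρ₂ n = blockSurvival k β (Equiv.swap 0 1) 1 n := by
  set x := ρ₂⁻¹ (ρ₁ 0) with hx
  have hx0 : x ≠ 0 := by
    rw [hx, Ne, Equiv.Perm.inv_eq_iff_eq]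
    exact fun h' => h h'
  set π₂ : Equiv.Perm (Fin (m + 2)) := Equiv.swap 1 x with hπ₂
  set π₁ : Equiv.Perm (Fin (m + 2)) := Equiv.swap 0 1 * (π₂ * (ρ₂⁻¹ * ρ₁)) with hπ₁
  have h2 : π₂ 0 = 0 := Equiv.swap_apply_of_ne_of_ne (by simp) hx0.symm
  have h1 : π₁ 0 = 0 := by
    simp only [hπ₁, Equiv.Perm.mul_apply]
    rw [← hx, hπ₂, Equiv.swap_apply_right, Equiv.swap_apply_right]
  unfold blockSurvival
  symm
  rw [← hβ π₁ h1]
  refine congrArg _ (funext fun w => ?_)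
  rw [← hβ π₂ h2]
  refine congrArg _ (funext fun w' => ?_)
  refine Finset.prod_congr rfl fun t _ => ?_
  rw [← apart_apply_apply (π₂ * ρ₂⁻¹).injective (ρ₁ _)]
  simp [hπ₁]

lemma expectedMeetingTime_markovStrategy {m : ℕ} (k : ℕ) [NeZero k]
    {β : PMF (Fin k → Fin (m + 2))} (hβ : RelabelInvariant β) {h₁ h₂ : Fin (m + 2)}
    (hne : h₁ ≠ h₂) :
    expectedMeetingTime h₁ h₂ (markovStrategy k β) =
      (∑ j ∈ Finset.range k, blockSurvival k β (Equiv.swap 0 1) 1 j) *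
        (1 - blockSurvival k β (Equiv.swap 0 1) 1 k)⁻¹ := by
  have hn : ∀ h : Fin (m + 2), Nonempty (Labelling h) := fun h =>
    ⟨⟨Equiv.swap 0 h, Equiv.swap_apply_left 0 h⟩⟩
  have h0 : ∀ h : Fin (m + 2), (Fintype.card (Labelling h) : ℝ≥0∞) ≠ 0 := fun h => by
    have := hn h
    exact_mod_cast Fintype.card_ne_zero
  unfold expectedMeetingTime
  have h (σ₁ : Labelling h₁) (σ₂ : Labelling h₂) :=
    lintegral_meetingTime_markovStrategy k β σ₁.1 σ₂.1
  simp only [fun (σ₁ : Labelling h₁) (σ₂ : Labelling h₂) =>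
    hβ.blockSurvival_eq (ρ₁ := σ₁.1) (ρ₂ := σ₂.1) (by rwa [σ₁.2, σ₂.2])] at h
  simp only [h]
  simp only [Finset.sum_const, nsmul_eq_mul, Finset.card_univ]
  rw [← mul_assoc, mul_comm, mul_div_assoc, ENNReal.div_self, mul_one]
  · exact mul_ne_zero (h0 _) (h0 _)
  · exact ENNReal.mul_ne_top (ENNReal.natCast_ne_top _) (ENNReal.natCast_ne_top _)

/-- The label of the location occupied after step `t + 1` of a t-step: the home if `u = none`, and
the location prescribed by the tour `τ` if `u = some τ`. -/
def tStepLabel {m : ℕ} [NeZero m] (u : Option (Tour m)) (t : ℕ) : Fin (m + 1) :=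
  u.elim 0 fun τ => (τ (Fin.ofNat m t)).succ

/-- The indicator of the players, who spend a t-step as prescribed by `u` and `v`, not meeting
during its first `n` steps. -/
def tStepSurvival {R : Type*} [CommSemiring R] (u v : Option (Tour 3)) (n : ℕ) : R :=
  ∏ t ∈ Finset.range n, apart (Equiv.swap 0 1 (tStepLabel u t)) (tStepLabel v t)

/-- The number of steps of a t-step that are played when the players spend it as prescribed by
`u` and `v`. -/
def tStepDuration {R : Type*} [CommSemiring R] (u v : Option (Tour 3)) : R :=
  ∑ n ∈ Finset.range 3, tStepSurvival u v n

lemma tStepSurvival_none_none {R : Type*} [CommSemiring R] (n : ℕ) :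
    (tStepSurvival none none n : R) = 1 :=
  Finset.prod_eq_one fun t _ => by simp [tStepLabel, apart]

lemma tStepDuration_none_none {R : Type*} [CommSemiring R] :
    (tStepDuration none none : R) = 3 := by
  simp [tStepDuration, tStepSurvival_none_none]

lemma cast_tStepSurvival {R : Type*} [CommSemiring R] (u v : Option (Tour 3)) (n : ℕ) :
    ((tStepSurvival u v n : ℕ) : R) = tStepSurvival u v n := by
  simp [tStepSurvival, apart]

lemma cast_tStepDuration {R : Type*} [CommSemiring R] (u v : Option (Tour 3)) :
    ((tStepDuration u v : ℕ) : R) = tStepDuration u v := by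
  simp [tStepDuration, cast_tStepSurvival]

lemma tStepSurvival_none_some {R : Type*} [CommSemiring R] (τ : Tour 3) :
    (tStepSurvival none (some τ) 3 : R) = 0 := by
  have : (tStepSurvival none (some τ) 3 : ℕ) = 0 := by
    revert τ
    decide
  rw [← cast_tStepSurvival, this, Nat.cast_zero]

lemma tStepSurvival_some_none {R : Type*} [CommSemiring R] (τ : Tour 3) :
    (tStepSurvival (some τ) none 3 : R) = 0 := by
  have : (tStepSurvival (some τ) none 3 : ℕ) = 0 := by
    revert τ
    decide
  rw [← cast_tStepSurvival, this, Nat.cast_zero]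

/-- How the player spends the t-step `i`, when `s` lists the t-steps spent at home, and `τ` lists
the successive tours. -/
def tStepChoice {m : ℕ} (s : ℕ → Bool) (τ : ℕ → Tour m) (i : ℕ) : Option (Tour m) :=
  if s i then none else some (τ (Nat.count (fun j => s j = false) i))

/-- The tours that remain after a t-step that was spent at home iff `b`. -/
def remainingTours {m : ℕ} (b : Bool) (τ : ℕ → Tour m) : ℕ → Tour m :=
  if b then τ else fun j => τ (j + 1)

lemma tStepChoice_zero {m : ℕ} (s : ℕ → Bool) (τ : ℕ → Tour m) :
    tStepChoice s τ 0 = if s 0 then none else some (τ 0) := by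
  simp [tStepChoice]

lemma tStepChoice_succ {m : ℕ} (s : ℕ → Bool) (τ : ℕ → Tour m) (i : ℕ) :
    tStepChoice s τ (i + 1) = tStepChoice (fun j => s (j + 1)) (remainingTours (s 0) τ) i := by
  unfold tStepChoice remainingTours
  rw [Nat.count_succ']
  cases s 0 <;> simp

/-- The indicator of the players not meeting during `r` t-steps. -/
noncomputable def survival (r : ℕ) (s s' : ℕ → Bool) (τ τ' : ℕ → Tour 3) : ℝ≥0∞ :=
  ∏ i ∈ Finset.range r, tStepSurvival (tStepChoice s τ i) (tStepChoice s' τ' i) 3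

/-- The number of steps of `r` t-steps that are played. -/
noncomputable def duration (r : ℕ) (s s' : ℕ → Bool) (τ τ' : ℕ → Tour 3) : ℝ≥0∞ :=
  ∑ i ∈ Finset.range r,
    survival i s s' τ τ' * tStepDuration (tStepChoice s τ i) (tStepChoice s' τ' i)

lemma survival_succ (r : ℕ) (s s' : ℕ → Bool) (τ τ' : ℕ → Tour 3) :
    survival (r + 1) s s' τ τ' =
      tStepSurvival (tStepChoice s τ 0) (tStepChoice s' τ' 0) 3 *
        survival r (fun j => s (j + 1)) (fun j => s' (j + 1))
          (remainingTours (s 0) τ) (remainingTours (s' 0) τ') := by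
  simp only [survival, Finset.prod_range_succ', tStepChoice_succ]
  rw [mul_comm]

lemma duration_succ (r : ℕ) (s s' : ℕ → Bool) (τ τ' : ℕ → Tour 3) :
    duration (r + 1) s s' τ τ' =
      tStepDuration (tStepChoice s τ 0) (tStepChoice s' τ' 0) +
        tStepSurvival (tStepChoice s τ 0) (tStepChoice s' τ' 0) 3 *
          duration r (fun j => s (j + 1)) (fun j => s' (j + 1))
            (remainingTours (s 0) τ) (remainingTours (s' 0) τ') := by
  simp only [duration, Finset.sum_range_succ', tStepChoice_succ, survival_succ, Finset.mul_sum]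
  rw [add_comm]
  simp [survival, mul_assoc]

/-- The sequence that starts with the finite sequence `s` and continues with `true`. -/
def padTrue {r : ℕ} (s : Fin r → Bool) (i : ℕ) : Bool := if h : i < r then s ⟨i, h⟩ else true

lemma Fintype.sum_fin_succ_fun {α M : Type*} [Fintype α] [AddCommMonoid M] {n : ℕ}
    (F : (Fin (n + 1) → α) → M) : ∑ f, F f = ∑ a, ∑ g, F (Fin.cons a g) := by
  rw [← (Fin.consEquiv fun _ : Fin (n + 1) => α).sum_comp, Fintype.sum_prod_type]
  rfl

lemma lexp_stayLaw_succ (r : ℕ) (p : unitInterval) (f : (ℕ → Bool) → ℝ≥0∞) :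
    ((stayLaw (r + 1) p).lexp fun s => f (padTrue s)) =
      ENNReal.ofReal p * ((stayLaw r p).lexp fun s => f fun i => Nat.casesOn i true (padTrue s)) +
      ENNReal.ofReal (1 - p) *
        ((stayLaw r p).lexp fun s => f fun i => Nat.casesOn i false (padTrue s)) := by
  have h : ∀ (b : Bool) (s : Fin r → Bool),
      padTrue (Fin.cons b s : Fin (r + 1) → Bool) = fun i => Nat.casesOn i b (padTrue s) := by
    intro b s
    funext i
    cases i with
    | zero => simp [padTrue]
    | succ i =>
      simp only [padTrue, Nat.add_lt_add_iff_right]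
      congr 1
  simp only [PMF.lexp_eq_sum, Fintype.sum_fin_succ_fun, h, stayLaw, PMF.ofFintype_apply,
    Fin.prod_univ_succ, Fin.cons_zero, Fin.cons_succ, Fintype.sum_bool, Finset.mul_sum, mul_assoc,
    if_true, Bool.false_eq_true, if_false]

/-- The expectation of a function of the decisions of both players, with fixed tours. -/
noncomputable def stayExp (r : ℕ) (p : unitInterval)
    (F : (ℕ → Bool) → (ℕ → Bool) → ℝ≥0∞) : ℝ≥0∞ :=
  (stayLaw r p).lexp fun s => (stayLaw r p).lexp fun s' => F (padTrue s) (padTrue s')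

lemma stayExp_succ (r : ℕ) (p : unitInterval) (F : (ℕ → Bool) → (ℕ → Bool) → ℝ≥0∞) :
    stayExp (r + 1) p F =
      ENNReal.ofReal p ^ 2 *
        stayExp r p (fun s s' => F (fun i => Nat.casesOn i true s) fun i => Nat.casesOn i true s')
      + ENNReal.ofReal p * ENNReal.ofReal (1 - p) *
        (stayExp r p (fun s s' => F (fun i => Nat.casesOn i true s) fun i => Nat.casesOn i false s')
        + stayExp r p
          (fun s s' => F (fun i => Nat.casesOn i false s) fun i => Nat.casesOn i true s'))
      + ENNReal.ofReal (1 - p) ^ 2 *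
        stayExp r p
          (fun s s' => F (fun i => Nat.casesOn i false s) fun i => Nat.casesOn i false s') := by
  have h := lexp_stayLaw_succ r p fun s => (stayLaw (r + 1) p).lexp fun s' => F s (padTrue s')
  unfold stayExp
  rw [h]
  simp only [fun s => lexp_stayLaw_succ r p (F s), PMF.lexp_add, PMF.lexp_const_mul]
  ring

lemma stayExp_const (r : ℕ) (p : unitInterval) (c : ℝ≥0∞) : stayExp r p (fun _ _ => c) = c := by
  simp [stayExp, PMF.lexp_const]

lemma stayExp_const_add (r : ℕ) (p : unitInterval) (c : ℝ≥0∞)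
    (F : (ℕ → Bool) → (ℕ → Bool) → ℝ≥0∞) :
    stayExp r p (fun s s' => c + F s s') = c + stayExp r p F := by
  simp [stayExp, PMF.lexp_const, PMF.lexp_add]

lemma stayExp_const_mul (r : ℕ) (p : unitInterval) (c : ℝ≥0∞)
    (F : (ℕ → Bool) → (ℕ → Bool) → ℝ≥0∞) :
    stayExp r p (fun s s' => c * F s s') = c * stayExp r p F := by
  simp [stayExp, PMF.lexp_const_mul]

lemma stayExp_survival_zero (p : unitInterval) (τ τ' : ℕ → Tour 3) :
    stayExp 0 p (fun s s' => survival 0 s s' τ τ') = 1 := by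
  simp [survival, stayExp_const]

lemma stayExp_survival_succ (r : ℕ) (p : unitInterval) (τ τ' : ℕ → Tour 3) :
    stayExp (r + 1) p (fun s s' => survival (r + 1) s s' τ τ') =
      ENNReal.ofReal p ^ 2 * stayExp r p (fun s s' => survival r s s' τ τ') +
      ENNReal.ofReal (1 - p) ^ 2 * (tStepSurvival (some (τ 0)) (some (τ' 0)) 3 *
        stayExp r p
          fun s s' => survival r s s' (fun j => τ (j + 1)) fun j => τ' (j + 1)) := by
  rw [stayExp_succ]
  simp [survival_succ, tStepChoice_zero, remainingTours, tStepSurvival_none_none,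
    tStepSurvival_none_some, tStepSurvival_some_none, stayExp_const, stayExp_const_mul]

lemma stayExp_duration_zero (p : unitInterval) (τ τ' : ℕ → Tour 3) :
    stayExp 0 p (fun s s' => duration 0 s s' τ τ') = 0 := by
  simp [duration, stayExp_const]

lemma stayExp_duration_succ (r : ℕ) (p : unitInterval) (τ τ' : ℕ → Tour 3) :
    stayExp (r + 1) p (fun s s' => duration (r + 1) s s' τ τ') =
      ENNReal.ofReal p ^ 2 * (3 + stayExp r p (fun s s' => duration r s s' τ τ')) +
      ENNReal.ofReal p * ENNReal.ofReal (1 - p) *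
        (tStepDuration none (some (τ' 0)) + tStepDuration (some (τ 0)) none) +
      ENNReal.ofReal (1 - p) ^ 2 * (tStepDuration (some (τ 0)) (some (τ' 0)) +
        tStepSurvival (some (τ 0)) (some (τ' 0)) 3 *
          stayExp r p
            fun s s' => duration r s s' (fun j => τ (j + 1)) fun j => τ' (j + 1)) := by
  rw [stayExp_succ]
  simp [duration_succ, tStepChoice_zero, remainingTours, tStepSurvival_none_none,
    tStepSurvival_none_some, tStepSurvival_some_none, tStepDuration_none_none, stayExp_const,
    stayExp_const_add, stayExp_const_mul]

/-- The expectation of a function of the tours of both players. -/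
noncomputable def tourExp (l : PMF (ℕ → Tour 3)) (F : (ℕ → Tour 3) → (ℕ → Tour 3) → ℝ≥0∞) :
    ℝ≥0∞ :=
  l.lexp fun τ => l.lexp fun τ' => F τ τ'

lemma tourExp_add (l : PMF (ℕ → Tour 3)) (F G : (ℕ → Tour 3) → (ℕ → Tour 3) → ℝ≥0∞) :
    tourExp l (fun τ τ' => F τ τ' + G τ τ') = tourExp l F + tourExp l G := by
  simp [tourExp, PMF.lexp_add]

lemma tourExp_const_mul (l : PMF (ℕ → Tour 3)) (c : ℝ≥0∞)
    (F : (ℕ → Tour 3) → (ℕ → Tour 3) → ℝ≥0∞) :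
    tourExp l (fun τ τ' => c * F τ τ') = c * tourExp l F := by
  simp [tourExp, PMF.lexp_const_mul]

/-- The indicator of the players not meeting during their first `k` tours, if these are
simultaneous. -/
def toursSurvival {R : Type*} [CommSemiring R] (k : ℕ) (τ τ' : ℕ → Tour 3) : R :=
  ∏ j ∈ Finset.range k, tStepSurvival (some (τ j)) (some (τ' j)) 3

/-- The total number of steps that the two players, while touring and waiting for each other at
home, need in order to meet. -/
def visitDuration {R : Type*} [CommSemiring R] (τ τ' : Tour 3) : R :=
  tStepDuration none (some τ') + tStepDuration (some τ) none

/-- The probability that the players meet neither during `k` simultaneous tours nor during the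
following `r` t-steps. -/
noncomputable def meanSurvival (l : PMF (ℕ → Tour 3)) (p : unitInterval) (r k : ℕ) : ℝ≥0∞ :=
  tourExp l fun τ τ' => toursSurvival k τ τ' *
    stayExp r p fun s s' => survival r s s' (fun j => τ (k + j)) fun j => τ' (k + j)

/-- The expected number of steps of `r` t-steps that are played after `k` simultaneous tours
(zero if the players meet during these tours). -/
noncomputable def meanDuration (l : PMF (ℕ → Tour 3)) (p : unitInterval) (r k : ℕ) : ℝ≥0∞ :=
  tourExp l fun τ τ' => toursSurvival k τ τ' *
    stayExp r p fun s s' => duration r s s' (fun j => τ (k + j)) fun j => τ' (k + j)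

lemma meanSurvival_zero (l : PMF (ℕ → Tour 3)) (p : unitInterval) (k : ℕ) :
    meanSurvival l p 0 k = tourExp l (toursSurvival k) := by
  simp [meanSurvival, stayExp_survival_zero]

lemma toursSurvival_succ {R : Type*} [CommSemiring R] (k : ℕ) (τ τ' : ℕ → Tour 3) :
    (toursSurvival (k + 1) τ τ' : R) =
      toursSurvival k τ τ' * tStepSurvival (some (τ k)) (some (τ' k)) 3 :=
  Finset.prod_range_succ _ _

lemma meanSurvival_succ (l : PMF (ℕ → Tour 3)) (p : unitInterval) (r k : ℕ) :
    meanSurvival l p (r + 1) k = ENNReal.ofReal p ^ 2 * meanSurvival l p r k +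
      ENNReal.ofReal (1 - p) ^ 2 * meanSurvival l p r (k + 1) := by
  simp only [meanSurvival, stayExp_survival_succ, toursSurvival_succ, ← tourExp_const_mul,
    ← tourExp_add, add_zero]
  refine congrArg _ (funext₂ fun τ τ' => ?_)
  simp only [add_right_comm k, ← add_assoc]
  ring

lemma meanDuration_zero (l : PMF (ℕ → Tour 3)) (p : unitInterval) (k : ℕ) :
    meanDuration l p 0 k = 0 := by
  simp [meanDuration, stayExp_duration_zero, tourExp, PMF.lexp_const]

lemma meanDuration_succ (l : PMF (ℕ → Tour 3)) (p : unitInterval) (r k : ℕ) :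
    meanDuration l p (r + 1) k =
      ENNReal.ofReal p ^ 2 * (3 * tourExp l (toursSurvival k) + meanDuration l p r k) +
      ENNReal.ofReal p * ENNReal.ofReal (1 - p) *
        tourExp l (fun τ τ' => toursSurvival k τ τ' * visitDuration (τ k) (τ' k)) +
      ENNReal.ofReal (1 - p) ^ 2 *
        (tourExp l (fun τ τ' => toursSurvival k τ τ' *
          tStepDuration (some (τ k)) (some (τ' k))) + meanDuration l p r (k + 1)) := by
  simp only [meanDuration, stayExp_duration_succ, toursSurvival_succ, ← tourExp_const_mul,
    ← tourExp_add, add_zero, visitDuration]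
  refine congrArg _ (funext₂ fun τ τ' => ?_)
  simp only [add_right_comm k, ← add_assoc]
  ring

/-- The block law `β` consists of `r` t-steps of `3` steps each, in each of which the player
independently stays home with probability `p` and otherwise makes the next one of the tours drawn
from `l`. -/
def HasTSteps {k : ℕ} (β : PMF (Fin k → Fin 4)) (r : ℕ) (p : unitInterval)
    (l : PMF (ℕ → Tour 3)) : Prop :=
  ∀ f : (Fin k → Fin 4) → ℝ≥0∞, β.lexp f = (stayLaw r p).lexp fun s => l.lexp fun τ =>
    f fun t => tStepLabel (tStepChoice (padTrue s) τ (t / 3)) t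

lemma HasTSteps.relabelInvariant {k : ℕ} {β : PMF (Fin k → Fin 4)} {r : ℕ} {p : unitInterval}
    {l : PMF (ℕ → Tour 3)} (hβ : HasTSteps β r p l)
    (hl : ∀ (g : Tour 3) (f : (ℕ → Tour 3) → ℝ≥0∞),
      (l.lexp fun τ => f fun j => g * τ j) = l.lexp f) :
    RelabelInvariant (m := 3) β := by
  intro π hπ f
  obtain ⟨⟨x, g⟩, rfl⟩ := Equiv.Perm.decomposeFin.symm.surjective π
  obtain rfl : x = 0 := by simpa using hπ
  rw [hβ, hβ f]
  refine congrArg _ (funext fun s => ?_)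
  symm
  rw [← hl g]
  refine congrArg _ (funext fun τ => congrArg f (funext fun t => ?_))
  by_cases h : padTrue s (t / 3) <;> simp [tStepChoice, tStepLabel, h]

lemma tStepLabel_mul_add {m : ℕ} [NeZero m] (u : Option (Tour m)) (i t : ℕ) :
    tStepLabel u (m * i + t) = tStepLabel u t := by
  have : Fin.ofNat m (m * i + t) = Fin.ofNat m t := by ext; simp [Fin.ofNat]
  simp only [tStepLabel, this]

lemma prod_apart_eq_survival (i n : ℕ) (hn : n ≤ 3) (s s' : ℕ → Bool) (τ τ' : ℕ → Tour 3) :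
    (∏ t ∈ Finset.range (3 * i + n),
      apart (Equiv.swap 0 1 (tStepLabel (tStepChoice s τ (t / 3)) t))
        (tStepLabel (tStepChoice s' τ' (t / 3)) t) : ℝ≥0∞) =
      survival i s s' τ τ' * tStepSurvival (tStepChoice s τ i) (tStepChoice s' τ' i) n := by
  have hdiv : ∀ i t, t < 3 → (3 * i + t) / 3 = i := fun i t ht => by omega
  rw [Finset.prod_range_mul_add]
  congr 1
  · refine Finset.prod_congr rfl fun i _ => Finset.prod_congr rfl fun t ht => ?_
    rw [hdiv i t (Finset.mem_range.1 ht), tStepLabel_mul_add, tStepLabel_mul_add]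
  · refine Finset.prod_congr rfl fun t ht => ?_
    rw [hdiv i t ((Finset.mem_range.1 ht).trans_le hn), tStepLabel_mul_add, tStepLabel_mul_add]

namespace HasTSteps

variable {k : ℕ} [NeZero k] {β : PMF (Fin k → Fin 4)} {r : ℕ} {p : unitInterval}
  {l : PMF (ℕ → Tour 3)}

lemma blockSurvival_eq (hβ : HasTSteps β r p l) {i n : ℕ} (hn : n ≤ 3) (hi : 3 * i + n ≤ k) :
    blockSurvival (m := 3) k β (Equiv.swap 0 1) 1 (3 * i + n) = tourExp l fun τ τ' =>
      stayExp r p fun s s' => survival i s s' τ τ' *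
        tStepSurvival (tStepChoice s τ i) (tStepChoice s' τ' i) n := by
  have h : ∀ s s' τ τ', (∏ t ∈ Finset.range (3 * i + n),
      apart (Equiv.swap 0 1
        (tStepLabel (tStepChoice s τ ((Fin.ofNat k t : Fin k) / 3)) (Fin.ofNat k t : Fin k)))
        ((1 : Equiv.Perm (Fin 4)) (tStepLabel (tStepChoice s' τ' ((Fin.ofNat k t : Fin k) / 3))
          (Fin.ofNat k t : Fin k))) : ℝ≥0∞) =
      survival i s s' τ τ' * tStepSurvival (tStepChoice s τ i) (tStepChoice s' τ' i) n := by
    intro s s' τ τ'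
    rw [← prod_apart_eq_survival i n hn]
    refine Finset.prod_congr rfl fun t ht => ?_
    have ht' : ((Fin.ofNat k t : Fin k) : ℕ) = t :=
      Nat.mod_eq_of_lt ((Finset.mem_range.1 ht).trans_le hi)
    rw [ht', Equiv.Perm.one_apply]
  unfold blockSurvival tourExp stayExp
  rw [hβ]
  refine (PMF.lexp_comm _ _ _).trans (congrArg _ (funext fun τ => ?_))
  refine (congrArg _ (funext fun s => ?_)).trans (PMF.lexp_comm _ _ _)
  rw [hβ]
  refine (PMF.lexp_comm _ _ _).trans (congrArg _ (funext fun τ' => ?_))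
  exact congrArg _ (funext fun s' => h _ _ _ _)

lemma blockSurvival_eq_meanSurvival (hβ : HasTSteps β r p l) (hk : k = 3 * r) :
    blockSurvival (m := 3) k β (Equiv.swap 0 1) 1 k = meanSurvival l p r 0 := by
  have h := hβ.blockSurvival_eq (i := r) (n := 0) (by norm_num) hk.ge
  rw [add_zero, ← hk] at h
  simp [h, meanSurvival, toursSurvival, tStepSurvival]

lemma sum_blockSurvival_eq_meanDuration (hβ : HasTSteps β r p l) (hk : k = 3 * r) :
    ∑ n ∈ Finset.range k, blockSurvival (m := 3) k β (Equiv.swap 0 1) 1 n =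
      meanDuration l p r 0 := by
  rw [show Finset.range k = Finset.range (3 * r + 0) by rw [hk, add_zero],
    Finset.sum_range_mul_add]
  rw [Finset.sum_congr rfl fun i hi => Finset.sum_congr rfl fun n hn =>
    hβ.blockSurvival_eq (i := i) (n := n) (Finset.mem_range.1 hn).le
      (by have := Finset.mem_range.1 hi; have := Finset.mem_range.1 hn; omega)]
  simp only [tourExp, stayExp, ← PMF.lexp_sum]
  simp [meanDuration, tourExp, stayExp, toursSurvival, duration, tStepDuration, Finset.mul_sum]

lemma expectedMeetingTime_eq (hβ : HasTSteps β r p l) (hk : k = 3 * r)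
    (hl : ∀ (g : Tour 3) (f : (ℕ → Tour 3) → ℝ≥0∞), (l.lexp fun τ => f fun j => g * τ j) = l.lexp f)
    {h₁ h₂ : Fin 4} (hne : h₁ ≠ h₂) :
    expectedMeetingTime (m := 3) h₁ h₂ (markovStrategy k β) =
      meanDuration l p r 0 * (1 - meanSurvival l p r 0)⁻¹ := by
  rw [← hβ.blockSurvival_eq_meanSurvival hk, ← hβ.sum_blockSurvival_eq_meanDuration hk]
  exact expectedMeetingTime_markovStrategy (m := 2) k (hβ.relabelInvariant hl) hne

end HasTSteps

lemma PMF.lexp_uniformOfFintype {α : Type*} [Fintype α] [Nonempty α] (f : α → ℝ≥0∞) :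
    (PMF.uniformOfFintype α).lexp f = (Fintype.card α : ℝ≥0∞)⁻¹ * ∑ a, f a := by
  simp [PMF.lexp_eq_sum, Finset.mul_sum]

lemma PMF.lexp_uniformOfFintype_comp {α : Type*} [Fintype α] [Nonempty α] (e : α ≃ α)
    (f : α → ℝ≥0∞) :
    ((PMF.uniformOfFintype α).lexp fun a => f (e a)) = (PMF.uniformOfFintype α).lexp f := by
  rw [lexp_uniformOfFintype, lexp_uniformOfFintype, e.sum_comp]

/-- The law of the sequence of the tours of the improved strategy. -/
noncomputable def improvedTours : PMF (ℕ → Tour 3) :=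
  fourToursLaw.map fun τ j => τ (Fin.ofNat 4 j)

/-- The law of the sequence of the tours of the Anderson–Weber strategy on `K₄`. -/
noncomputable def andersonWeberTours : PMF (ℕ → Tour 3) :=
  (PMF.uniformOfFintype (Tour 3)).map fun τ _ => τ

lemma count_padTrue_eq_toursBefore (s : Fin 4 → Bool) (i : Fin 4) :
    Fin.ofNat 4 (Nat.count (fun j => padTrue s j = false) i) = toursBefore s i := by
  revert s i
  decide

lemma hasTSteps_improvedBlock (p : unitInterval) :
    HasTSteps (improvedBlock p) 4 p improvedTours := by
  intro f
  rw [improvedBlock, PMF.lexp_bind]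
  refine congrArg _ (funext fun s => ?_)
  rw [PMF.lexp_map, improvedTours, PMF.lexp_map]
  refine congrArg _ (funext fun τ => congrArg f (funext fun t => ?_))
  have ht : (t : ℕ) / 3 < 4 := by omega
  have hi : Fin.ofNat 4 ((t : ℕ) / 3) = ⟨t / 3, ht⟩ := Fin.ext (Nat.mod_eq_of_lt ht)
  have h := count_padTrue_eq_toursBefore s ⟨t / 3, ht⟩
  have hs : padTrue s ((t : ℕ) / 3) = s ⟨t / 3, ht⟩ := dif_pos ht
  simp only [tStepChoice, hi, hs]
  split_ifs
  · rfl
  · rw [← h]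
    rfl

lemma hasTSteps_awBlock (p : unitInterval) :
    HasTSteps (awBlock 3 p) 1 p andersonWeberTours := by
  intro f
  rw [awBlock, PMF.lexp_bind]
  refine congrArg _ (funext fun s => ?_)
  rw [PMF.lexp_map, andersonWeberTours, PMF.lexp_map]
  refine congrArg _ (funext fun τ => congrArg f (funext fun t => ?_))
  have ht : (t : ℕ) / 3 = 0 := by omega
  simp only [tStepChoice, ht, padTrue, Nat.lt_one_iff, dite_true]
  cases h : s 0 <;> simp [tStepLabel, h]

lemma lexp_improvedTours_mul (g : Tour 3) (f : (ℕ → Tour 3) → ℝ≥0∞) :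
    (improvedTours.lexp fun τ => f fun j => g * τ j) = improvedTours.lexp f := by
  simp only [improvedTours, fourToursLaw, PMF.lexp_map, PMF.lexp_bind, Function.comp_def]
  refine congrArg _ (funext fun q => ?_)
  exact PMF.lexp_uniformOfFintype_comp
    ((Equiv.refl (Fin 4)).embeddingCongr (Equiv.mulLeft g))
    fun e : Fin 4 ↪ Tour 3 => f fun j => e (pattern q (Fin.ofNat 4 j))

lemma lexp_andersonWeberTours_mul (g : Tour 3) (f : (ℕ → Tour 3) → ℝ≥0∞) :
    (andersonWeberTours.lexp fun τ => f fun j => g * τ j) = andersonWeberTours.lexp f := by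
  simp only [andersonWeberTours, PMF.lexp_map, Function.comp_def]
  exact PMF.lexp_uniformOfFintype_comp (Equiv.mulLeft g) fun τ : Tour 3 => f fun _ => τ

/-- An enumeration of the six tours on `K₄`. -/
def tourOf : Fin 6 → Tour 3 :=
  ![⟨![0, 1, 2], ![0, 1, 2], by decide, by decide⟩, ⟨![0, 2, 1], ![0, 2, 1], by decide, by decide⟩,
    ⟨![1, 0, 2], ![1, 0, 2], by decide, by decide⟩, ⟨![1, 2, 0], ![2, 0, 1], by decide, by decide⟩,
    ⟨![2, 0, 1], ![1, 2, 0], by decide, by decide⟩, ⟨![2, 1, 0], ![2, 1, 0], by decide, by decide⟩]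

lemma tourOf_injective : tourOf.Injective := by decide

lemma tourOf_bijective : tourOf.Bijective :=
  (Fintype.bijective_iff_injective_and_card _).2
    ⟨tourOf_injective, by simp [Fintype.card_perm, Nat.factorial]⟩

/-- Whether four numbers are distinct. -/
def allDistinct (a b c d : ℕ) : Bool :=
  !(Nat.beq a b || Nat.beq a c || Nat.beq a d || Nat.beq b c || Nat.beq b d || Nat.beq c d)

/-- The probability, times `1080`, of a quadruple of tours under `fourToursLaw`. -/
def weight4 (a b c d : ℕ) : ℕ :=
  match Nat.beq a b, Nat.beq a c, Nat.beq a d, Nat.beq b c, Nat.beq b d, Nat.beq c d with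
  | true, true, false, _, _, _ => 3
  | true, false, true, _, _, _ => 3
  | false, true, true, _, _, _ => 3
  | false, false, false, true, true, _ => 3
  | false, false, false, false, false, false => 2
  | _, _, _, _, _, _ => 0

/-- The probability, times `1080`, of the first three tours under `fourToursLaw`. -/
def weight3 (a b c : ℕ) : ℕ :=
  weight4 a b c 0 + weight4 a b c 1 + weight4 a b c 2 + weight4 a b c 3 + weight4 a b c 4 +
    weight4 a b c 5

/-- The probability, times `1080`, of the first two tours under `fourToursLaw`. -/
def weight2 (a b : ℕ) : ℕ :=
  weight3 a b 0 + weight3 a b 1 + weight3 a b 2 + weight3 a b 3 + weight3 a b 4 + weight3 a b 5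

lemma sum_embedding (F : (Fin 4 → Tour 3) → ℝ≥0∞) :
    ∑ e : Fin 4 ↪ Tour 3, F e = ∑ a : Fin 6, ∑ b : Fin 6, ∑ c : Fin 6, ∑ d : Fin 6,
      if allDistinct a b c d then F ![tourOf a, tourOf b, tourOf c, tourOf d] else 0 := by
  classical
  rw [← (Equiv.subtypeInjectiveEquivEmbedding (Fin 4) (Tour 3)).sum_comp]
  have h1 : ∑ f ∈ Finset.univ.filter fun f : Fin 4 → Tour 3 => f.Injective, F f =
      ∑ f : {f : Fin 4 → Tour 3 // f.Injective}, F f :=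
    Finset.sum_subtype _ (by simp) F
  refine h1.symm.trans ?_
  rw [Finset.sum_filter]
  simp only [Fintype.sum_fin_succ_fun, ← tourOf_bijective.sum_comp]
  refine Finset.sum_congr rfl fun a _ => Finset.sum_congr rfl fun b _ =>
    Finset.sum_congr rfl fun c _ => Finset.sum_congr rfl fun d _ => ?_
  have h2 (g : Fin 0 → Tour 3) : (Fin.cons (tourOf a) (Fin.cons (tourOf b) (Fin.cons (tourOf c)
      (Fin.cons (tourOf d) g))) : Fin 4 → Tour 3) = tourOf ∘ ![a, b, c, d] := by
    funext i
    fin_cases i <;> rfl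
  have h3 : (![a, b, c, d] : Fin 4 → Fin 6).Injective ↔ allDistinct a b c d := by
    have hb (x y : Fin 6) : Nat.beq x y = decide (x = y) := by
      rw [Bool.eq_iff_iff, decide_eq_true_iff, Nat.beq_eq, Fin.ext_iff]
    simp only [Matrix.vecCons, Fin.cons_injective_iff, Function.injective_of_subsingleton,
      Set.mem_range, Fin.exists_fin_succ, Fin.cons_zero, Fin.cons_succ, allDistinct, hb]
    simp
    grind
  have h4 : tourOf ∘ ![a, b, c, d] = ![tourOf a, tourOf b, tourOf c, tourOf d] := by
    funext i
    fin_cases i <;> rfl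
  simp only [h2, tourOf_injective.of_comp_iff, h3, Finset.univ_unique, Finset.sum_singleton]
  rw [h4]

lemma sum_weight4_mul (f : Fin 6 → Fin 6 → Fin 6 → Fin 6 → ℝ≥0∞) :
    ∑ a : Fin 6, ∑ b : Fin 6, ∑ c : Fin 6, ∑ d : Fin 6, (weight4 a b c d : ℝ≥0∞) * f a b c d =
      3 * (∑ a : Fin 6, ∑ b : Fin 6, if a = b then 0 else
        f a a a b + f a a b a + f a b a a + f a b b b) +
      2 * ∑ a : Fin 6, ∑ b : Fin 6, ∑ c : Fin 6, ∑ d : Fin 6,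
        if allDistinct a b c d then f a b c d else 0 := by
  have h : ∀ a b c d : Fin 6, weight4 a b c d =
      3 * ((if a = b then if a = c then if a = d then 0 else 1 else 0 else 0) +
        (if a = b then if a = d then if a = c then 0 else 1 else 0 else 0) +
        (if a = c then if a = d then if a = b then 0 else 1 else 0 else 0) +
        (if b = c then if b = d then if a = b then 0 else 1 else 0 else 0)) +
      2 * (if allDistinct a b c d then 1 else 0) := by
    decide +kernel
  simp only [h]
  push_cast
  simp only [add_mul, mul_assoc, Finset.sum_add_distrib, ← Finset.mul_sum, ite_mul, zero_mul,
    one_mul, mul_add]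
  have h' : ∀ a b : Fin 6, (if a = b then 0 else
      f a a a b + f a a b a + f a b a a + f a b b b) =
      (if a = b then 0 else f a a a b) + (if a = b then 0 else f a a b a) +
        (if a = b then 0 else f a b a a) + (if a = b then 0 else f a b b b) := by
    intro a b
    split_ifs <;> simp
  simp [h', Finset.sum_add_distrib, mul_add]

lemma sum_ite_allDistinct (g : Fin 6 → Fin 6 → ℝ≥0∞) :
    ∑ a : Fin 6, ∑ b : Fin 6, ∑ c : Fin 6, ∑ d : Fin 6,
      (if allDistinct a b c d then g a b else 0) =
      12 * ∑ a : Fin 6, ∑ b : Fin 6, if a = b then 0 else g a b := by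
  have h : ∀ a b : Fin 6, ∑ c : Fin 6, ∑ d : Fin 6, (if allDistinct a b c d then 1 else 0) =
      if a = b then 0 else 12 := by
    decide +kernel
  rw [Finset.mul_sum]
  refine Finset.sum_congr rfl fun a _ => ?_
  rw [Finset.mul_sum]
  refine Finset.sum_congr rfl fun b _ => ?_
  have h' := congrArg (fun n : ℕ => (n : ℝ≥0∞) * g a b) (h a b)
  simp only [Nat.cast_sum, Nat.cast_ite, Nat.cast_one, Nat.cast_zero, Finset.sum_mul, ite_mul,
    one_mul, zero_mul] at h'
  rw [h', mul_ite, mul_zero]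
  norm_num

lemma lexp_fourToursLaw (f : (Fin 4 → Tour 3) → ℝ≥0∞) :
    fourToursLaw.lexp f = 1080⁻¹ * ∑ a : Fin 6, ∑ b : Fin 6, ∑ c : Fin 6, ∑ d : Fin 6,
      weight4 a b c d * f ![tourOf a, tourOf b, tourOf c, tourOf d] := by
  have hcard : Fintype.card (Fin 4 ↪ Tour 3) = 360 := by
    simp [Fintype.card_embedding_eq, Fintype.card_perm, Nat.factorial, Nat.descFactorial]
  have h0 (a b c d : Tour 3) : (fun j => ![a, b, c, d] (pattern 0 j)) = ![a, a, a, b] := by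
    funext j
    fin_cases j <;> rfl
  have h1 (a b c d : Tour 3) : (fun j => ![a, b, c, d] (pattern 1 j)) = ![a, a, b, a] := by
    funext j
    fin_cases j <;> rfl
  have h2 (a b c d : Tour 3) : (fun j => ![a, b, c, d] (pattern 2 j)) = ![a, b, a, a] := by
    funext j
    fin_cases j <;> rfl
  have h3 (a b c d : Tour 3) : (fun j => ![a, b, c, d] (pattern 3 j)) = ![a, b, b, b] := by
    funext j
    fin_cases j <;> rfl
  have h4 (a b c d : Tour 3) : (fun j => ![a, b, c, d] (pattern 4 j)) = ![a, b, c, d] := by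
    funext j
    fin_cases j <;> rfl
  have hc1 : (1 / 12 : ℝ≥0∞) * (((360 : ℕ) : ℝ≥0∞)⁻¹ * 12) = 1080⁻¹ * 3 := by
    rw [← ENNReal.toReal_eq_toReal_iff' (by finiteness) (by finiteness)]
    norm_num
  have hc2 : (2 / 3 : ℝ≥0∞) * ((360 : ℕ) : ℝ≥0∞)⁻¹ = 1080⁻¹ * 2 := by
    rw [← ENNReal.toReal_eq_toReal_iff' (by finiteness) (by finiteness)]
    norm_num
  simp only [fourToursLaw, PMF.lexp_bind, PMF.lexp_map, PMF.lexp_uniformOfFintype, hcard,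
    Function.comp_def]
  simp only [fun q => sum_embedding fun e => f fun j => e (pattern q j)]
  simp only [PMF.lexp_eq_sum, Fin.sum_univ_five, h0, h1, h2, h3, h4]
  rw [sum_weight4_mul fun a b c d => f ![tourOf a, tourOf b, tourOf c, tourOf d],
    sum_ite_allDistinct fun a b => f ![tourOf a, tourOf a, tourOf a, tourOf b],
    sum_ite_allDistinct fun a b => f ![tourOf a, tourOf a, tourOf b, tourOf a],
    sum_ite_allDistinct fun a b => f ![tourOf a, tourOf b, tourOf a, tourOf a],
    sum_ite_allDistinct fun a b => f ![tourOf a, tourOf b, tourOf b, tourOf b]]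
  have h' : ∀ a b : Fin 6, ∀ x y z w : ℝ≥0∞, (if a = b then 0 else x + y + z + w) =
      (if a = b then 0 else x) + (if a = b then 0 else y) +
        (if a = b then 0 else z) + (if a = b then 0 else w) := by
    intro a b x y z w
    split_ifs <;> simp
  have hl (i : Fin 5) : patternLaw i = ![1 / 12, 1 / 12, 1 / 12, 1 / 12, 2 / 3] i := rfl
  simp only [h', Finset.sum_add_distrib, hl, Matrix.cons_val]
  rw [mul_add, ← mul_assoc 1080⁻¹ 3, ← mul_assoc 1080⁻¹ 2, ← hc1, ← hc2]
  ring

/-- The sum of `f` over `0, …, 5`, in a form that is evaluated quickly by the kernel. -/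
def sumSix (f : ℕ → ℕ) : ℕ := f 0 + f 1 + f 2 + f 3 + f 4 + f 5

/-- The product of two natural numbers; `y` is not evaluated if `x` is zero. -/
def lazyMul (x y : ℕ) : ℕ := Nat.rec 0 (fun n _ => Nat.succ n * y) x

lemma sumSix_eq (f : ℕ → ℕ) : sumSix f = ∑ i : Fin 6, f i := by
  simp [sumSix, Fin.sum_univ_six]

lemma lazyMul_eq (x y : ℕ) : lazyMul x y = x * y := by
  cases x <;> simp [lazyMul]

/-- The indicator of the players not meeting during a t-step in which both of them tour. -/
def survivalTable (a b : ℕ) : ℕ := Nat.shiftRight 15263541594 (6 * a + b) % 2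

/-- The number of steps that are played in a t-step in which both players tour. -/
def durationTable (a b : ℕ) : ℕ := Nat.shiftRight 1769013922358452009982 (2 * (6 * a + b)) % 4

/-- The step of a tour that leads to the location labelled `1`. -/
def visitTable (a : ℕ) : ℕ := Nat.shiftRight 3813 (2 * a) % 4

/-- The function `F` of two tours is tabulated by `f`. -/
abbrev HasTable (F : Tour 3 → Tour 3 → ℕ) (f : ℕ → ℕ → ℕ) : Prop :=
  ∀ a b : Fin 6, F (tourOf a) (tourOf b) = f a b

lemma hasTable_tStepSurvival :
    HasTable (fun τ τ' => tStepSurvival (some τ) (some τ') 3) survivalTable := by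
  decide

lemma hasTable_tStepDuration :
    HasTable (fun τ τ' => tStepDuration (some τ) (some τ')) durationTable := by
  decide

lemma hasTable_visitDuration :
    HasTable visitDuration fun a b => visitTable a + visitTable b := by
  decide

lemma lexp_improvedTours_four (g : Tour 3 → Tour 3 → Tour 3 → Tour 3 → ℝ≥0∞) :
    (improvedTours.lexp fun τ => g (τ 0) (τ 1) (τ 2) (τ 3)) =
      1080⁻¹ * ∑ a : Fin 6, ∑ b : Fin 6, ∑ c : Fin 6, ∑ d : Fin 6,
        weight4 a b c d * g (tourOf a) (tourOf b) (tourOf c) (tourOf d) := by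
  rw [improvedTours, PMF.lexp_map, lexp_fourToursLaw]
  rfl

lemma lexp_improvedTours_three (g : Tour 3 → Tour 3 → Tour 3 → ℝ≥0∞) :
    (improvedTours.lexp fun τ => g (τ 0) (τ 1) (τ 2)) =
      1080⁻¹ * ∑ a : Fin 6, ∑ b : Fin 6, ∑ c : Fin 6,
        weight3 a b c * g (tourOf a) (tourOf b) (tourOf c) := by
  rw [lexp_improvedTours_four fun x y z _ => g x y z]
  simp only [← Finset.sum_mul, weight3]
  simp [Fin.sum_univ_six (fun i : Fin 6 => (weight4 _ _ _ i : ℝ≥0∞))]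

lemma lexp_improvedTours_two (g : Tour 3 → Tour 3 → ℝ≥0∞) :
    (improvedTours.lexp fun τ => g (τ 0) (τ 1)) =
      1080⁻¹ * ∑ a : Fin 6, ∑ b : Fin 6, weight2 a b * g (tourOf a) (tourOf b) := by
  rw [lexp_improvedTours_three fun x y _ => g x y]
  simp only [← Finset.sum_mul, weight2]
  simp [Fin.sum_univ_six (fun i : Fin 6 => (weight3 _ _ i : ℝ≥0∞))]

/-- The first tour drawn from `l` is uniformly distributed. -/
def UniformFirstTour (l : PMF (ℕ → Tour 3)) : Prop :=
  ∀ g : Tour 3 → ℝ≥0∞, (l.lexp fun τ => g (τ 0)) = 1080⁻¹ * ∑ a : Fin 6, 180 * g (tourOf a)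

lemma uniformFirstTour_improvedTours : UniformFirstTour improvedTours := by
  intro g
  rw [lexp_improvedTours_two fun x _ => g x]
  have h : ∀ a : Fin 6, ∑ b : Fin 6, weight2 a b = 180 := by decide +kernel
  simp only [← Finset.sum_mul, ← Nat.cast_sum, h]
  norm_num

lemma uniformFirstTour_andersonWeberTours : UniformFirstTour andersonWeberTours := by
  intro g
  have hc : (6 : ℝ≥0∞)⁻¹ = 1080⁻¹ * 180 := by
    rw [← ENNReal.toReal_eq_toReal_iff' (by finiteness) (by finiteness)]
    norm_num
  rw [andersonWeberTours, PMF.lexp_map, PMF.lexp_uniformOfFintype, ← Finset.mul_sum, ← mul_assoc,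
    ← hc, ← tourOf_bijective.sum_comp]
  simp [Fintype.card_perm, Nat.factorial]

/-- The sum of `f 0` over pairs of tours, with the weights given by the law of a tour. -/
def pairSum1 (f : ℕ → ℕ → ℕ) : ℕ :=
  sumSix fun a => lazyMul 180 <| sumSix fun a' => lazyMul (f a a') 180

/-- The sum of `f₀ f₁` over pairs of pairs of tours, weighted with `weight2`. -/
def pairSum2 (f₀ f₁ : ℕ → ℕ → ℕ) : ℕ :=
  sumSix fun a => sumSix fun b => lazyMul (weight2 a b) <|
    sumSix fun a' => lazyMul (f₀ a a') <| sumSix fun b' => lazyMul (f₁ b b') <| weight2 a' b'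

/-- The sum of `f₀ f₁ f₂` over pairs of triples of tours, weighted with `weight3`. -/
def pairSum3 (f₀ f₁ f₂ : ℕ → ℕ → ℕ) : ℕ :=
  sumSix fun a => sumSix fun b => sumSix fun c => lazyMul (weight3 a b c) <|
    sumSix fun a' => lazyMul (f₀ a a') <| sumSix fun b' => lazyMul (f₁ b b') <|
      sumSix fun c' => lazyMul (f₂ c c') <| weight3 a' b' c'

/-- The sum of `f₀ f₁ f₂ f₃` over pairs of quadruples of tours, weighted with `weight4`. -/
def pairSum4 (f₀ f₁ f₂ f₃ : ℕ → ℕ → ℕ) : ℕ :=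
  sumSix fun a => sumSix fun b => sumSix fun c => sumSix fun d => lazyMul (weight4 a b c d) <|
    sumSix fun a' => lazyMul (f₀ a a') <| sumSix fun b' => lazyMul (f₁ b b') <|
      sumSix fun c' => lazyMul (f₂ c c') <| sumSix fun d' => lazyMul (f₃ d d') <|
        weight4 a' b' c' d'

section PairSums

variable {F₀ F₁ F₂ F₃ : Tour 3 → Tour 3 → ℕ} {f₀ f₁ f₂ f₃ : ℕ → ℕ → ℕ}

lemma tourExp_eq_pairSum1 {l : PMF (ℕ → Tour 3)} (hl : UniformFirstTour l)
    (h₀ : HasTable F₀ f₀) :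
    tourExp l (fun τ τ' => ((F₀ (τ 0) (τ' 0) : ℕ) : ℝ≥0∞)) =
      1080⁻¹ ^ 2 * (pairSum1 f₀ : ℕ) := by
  rw [tourExp, hl fun x => l.lexp fun τ' => ((F₀ x (τ' 0) : ℕ) : ℝ≥0∞)]
  simp only [fun x => hl fun x' => ((F₀ x x' : ℕ) : ℝ≥0∞), h₀, pairSum1, sumSix_eq, lazyMul_eq]
  push_cast
  simp only [Finset.mul_sum]
  refine Finset.sum_congr rfl fun a _ => Finset.sum_congr rfl fun a' _ => ?_
  ring

lemma tourExp_eq_pairSum2 (h₀ : HasTable F₀ f₀)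
    (h₁ : HasTable F₁ f₁) :
    tourExp improvedTours
        (fun τ τ' => ((F₀ (τ 0) (τ' 0) * F₁ (τ 1) (τ' 1) : ℕ) : ℝ≥0∞)) =
      1080⁻¹ ^ 2 * (pairSum2 f₀ f₁ : ℕ) := by
  rw [tourExp, lexp_improvedTours_two fun x y => improvedTours.lexp
    fun τ' => ((F₀ x (τ' 0) * F₁ y (τ' 1) : ℕ) : ℝ≥0∞)]
  simp only [fun x y => lexp_improvedTours_two
    fun x' y' => ((F₀ x x' * F₁ y y' : ℕ) : ℝ≥0∞), h₀, h₁, pairSum2, sumSix_eq, lazyMul_eq]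
  push_cast
  simp only [Finset.mul_sum]
  refine Finset.sum_congr rfl fun a _ => Finset.sum_congr rfl fun b _ =>
    Finset.sum_congr rfl fun a' _ => Finset.sum_congr rfl fun b' _ => ?_
  ring

lemma tourExp_eq_pairSum3 (h₀ : HasTable F₀ f₀)
    (h₁ : HasTable F₁ f₁)
    (h₂ : HasTable F₂ f₂) :
    tourExp improvedTours
        (fun τ τ' => ((F₀ (τ 0) (τ' 0) * F₁ (τ 1) (τ' 1) * F₂ (τ 2) (τ' 2) : ℕ) : ℝ≥0∞)) =
      1080⁻¹ ^ 2 * (pairSum3 f₀ f₁ f₂ : ℕ) := by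
  rw [tourExp, lexp_improvedTours_three fun x y z => improvedTours.lexp
    fun τ' => ((F₀ x (τ' 0) * F₁ y (τ' 1) * F₂ z (τ' 2) : ℕ) : ℝ≥0∞)]
  simp only [fun x y z => lexp_improvedTours_three
    fun x' y' z' => ((F₀ x x' * F₁ y y' * F₂ z z' : ℕ) : ℝ≥0∞), h₀, h₁, h₂, pairSum3, sumSix_eq,
    lazyMul_eq]
  push_cast
  simp only [Finset.mul_sum]
  refine Finset.sum_congr rfl fun a _ => Finset.sum_congr rfl fun b _ =>
    Finset.sum_congr rfl fun c _ => Finset.sum_congr rfl fun a' _ =>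
    Finset.sum_congr rfl fun b' _ => Finset.sum_congr rfl fun c' _ => ?_
  ring

lemma tourExp_eq_pairSum4 (h₀ : HasTable F₀ f₀)
    (h₁ : HasTable F₁ f₁)
    (h₂ : HasTable F₂ f₂)
    (h₃ : HasTable F₃ f₃) :
    tourExp improvedTours
        (fun τ τ' => ((F₀ (τ 0) (τ' 0) * F₁ (τ 1) (τ' 1) * F₂ (τ 2) (τ' 2) *
          F₃ (τ 3) (τ' 3) : ℕ) : ℝ≥0∞)) =
      1080⁻¹ ^ 2 * (pairSum4 f₀ f₁ f₂ f₃ : ℕ) := by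
  rw [tourExp, lexp_improvedTours_four fun x y z u => improvedTours.lexp
    fun τ' => ((F₀ x (τ' 0) * F₁ y (τ' 1) * F₂ z (τ' 2) * F₃ u (τ' 3) : ℕ) : ℝ≥0∞)]
  simp only [fun x y z u => lexp_improvedTours_four
    fun x' y' z' u' => ((F₀ x x' * F₁ y y' * F₂ z z' * F₃ u u' : ℕ) : ℝ≥0∞), h₀, h₁, h₂, h₃,
    pairSum4, sumSix_eq, lazyMul_eq]
  push_cast
  simp only [Finset.mul_sum]
  refine Finset.sum_congr rfl fun a _ => Finset.sum_congr rfl fun b _ =>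
    Finset.sum_congr rfl fun c _ => Finset.sum_congr rfl fun d _ =>
    Finset.sum_congr rfl fun a' _ => Finset.sum_congr rfl fun b' _ =>
    Finset.sum_congr rfl fun c' _ => Finset.sum_congr rfl fun d' _ => ?_
  ring

end PairSums

lemma pairSum1_survivalTable : pairSum1 survivalTable = 583200 := by decide +kernel

lemma pairSum1_durationTable : pairSum1 durationTable = 2786400 := by decide +kernel

lemma pairSum1_visitTable : pairSum1 (fun a b => visitTable a + visitTable b) = 4665600 := by
  decide +kernel

lemma pairSum2_survivalTable : pairSum2 survivalTable survivalTable = 291600 := by decide +kernel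

lemma pairSum2_durationTable : pairSum2 survivalTable durationTable = 1393200 := by
  decide +kernel

lemma pairSum2_visitTable :
    pairSum2 survivalTable (fun a b => visitTable a + visitTable b) = 2332800 := by
  decide +kernel

lemma pairSum3_survivalTable : pairSum3 survivalTable survivalTable survivalTable = 145800 := by
  decide +kernel

lemma pairSum3_durationTable : pairSum3 survivalTable survivalTable durationTable = 696600 := by
  decide +kernel

lemma pairSum3_visitTable :
    pairSum3 survivalTable survivalTable (fun a b => visitTable a + visitTable b) = 1166400 := by
  decide +kernel

lemma pairSum4_survivalTable :
    pairSum4 survivalTable survivalTable survivalTable survivalTable = 72072 := by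
  decide +kernel

lemma pairSum4_durationTable :
    pairSum4 survivalTable survivalTable survivalTable durationTable = 347352 := by
  decide +kernel

lemma pairSum4_visitTable :
    pairSum4 survivalTable survivalTable survivalTable (fun a b => visitTable a + visitTable b) =
      583200 := by
  decide +kernel

/-- The value of `meanSurvival l p r k` when `u j` is the probability of not meeting during `j`
simultaneous tours. -/
def survivalPoly (u : ℕ → ℝ) (p : ℝ) : ℕ → ℕ → ℝ
  | 0, k => u k
  | r + 1, k => p ^ 2 * survivalPoly u p r k + (1 - p) ^ 2 * survivalPoly u p r (k + 1)

/-- The value of `meanDuration l p r k` when the expectations in the recursion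
`meanDuration_succ` are given by `u`, `v` and `w`. -/
def durationPoly (u v w : ℕ → ℝ) (p : ℝ) : ℕ → ℕ → ℝ
  | 0, _ => 0
  | r + 1, k => p ^ 2 * (3 * u k + durationPoly u v w p r k) + p * (1 - p) * v k +
      (1 - p) ^ 2 * (w k + durationPoly u v w p r (k + 1))

lemma survivalPoly_nonneg {u : ℕ → ℝ} (hu : ∀ k, 0 ≤ u k) (p : ℝ) (r k : ℕ) :
    0 ≤ survivalPoly u p r k := by
  induction r generalizing k with
  | zero => exact hu k
  | succ r ih =>
    have := ih k
    have := ih (k + 1)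
    rw [survivalPoly]
    positivity

lemma durationPoly_nonneg {u v w : ℕ → ℝ} (hu : ∀ k, 0 ≤ u k) (hv : ∀ k, 0 ≤ v k)
    (hw : ∀ k, 0 ≤ w k) (p : unitInterval) (r k : ℕ) : 0 ≤ durationPoly u v w p r k := by
  induction r generalizing k with
  | zero => exact le_rfl
  | succ r ih =>
    have := ih k
    have := ih (k + 1)
    have := hu k
    have := hv k
    have := hw k
    have := p.2.1
    have : 0 ≤ 1 - (p : ℝ) := sub_nonneg.2 p.2.2
    rw [durationPoly]
    positivity

lemma meanSurvival_eq_survivalPoly {l : PMF (ℕ → Tour 3)} {u : ℕ → ℝ} {n : ℕ}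
    (hu0 : ∀ k, 0 ≤ u k)
    (hu : ∀ k ≤ n, tourExp l (toursSurvival k) = ENNReal.ofReal (u k))
    (p : unitInterval) (r k : ℕ) (h : r + k ≤ n) :
    meanSurvival l p r k = ENNReal.ofReal (survivalPoly u p r k) := by
  induction r generalizing k with
  | zero => rw [meanSurvival_zero, hu k (by omega), survivalPoly]
  | succ r ih =>
    have hp : 0 ≤ 1 - (p : ℝ) := sub_nonneg.2 p.2.2
    have h1 := survivalPoly_nonneg hu0 p r k
    have h2 := survivalPoly_nonneg hu0 p r (k + 1)
    rw [meanSurvival_succ, ih k (by omega), ih (k + 1) (by omega), survivalPoly,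
      ENNReal.ofReal_add (by positivity) (by positivity), ENNReal.ofReal_mul (by positivity),
      ENNReal.ofReal_mul (by positivity), ENNReal.ofReal_pow p.2.1, ENNReal.ofReal_pow hp]

lemma meanDuration_eq_durationPoly {l : PMF (ℕ → Tour 3)} {u v w : ℕ → ℝ} {n : ℕ}
    (hu0 : ∀ k, 0 ≤ u k) (hv0 : ∀ k, 0 ≤ v k) (hw0 : ∀ k, 0 ≤ w k)
    (hu : ∀ k < n, tourExp l (toursSurvival k) = ENNReal.ofReal (u k))
    (hv : ∀ k < n, tourExp l (fun τ τ' => toursSurvival k τ τ' * visitDuration (τ k) (τ' k)) =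
      ENNReal.ofReal (v k))
    (hw : ∀ k < n, tourExp l (fun τ τ' => toursSurvival k τ τ' *
      tStepDuration (some (τ k)) (some (τ' k))) = ENNReal.ofReal (w k))
    (p : unitInterval) (r k : ℕ) (h : r + k ≤ n) :
    meanDuration l p r k = ENNReal.ofReal (durationPoly u v w p r k) := by
  induction r generalizing k with
  | zero => rw [meanDuration_zero, durationPoly, ENNReal.ofReal_zero]
  | succ r ih =>
    have hp0 := p.2.1
    have hp : 0 ≤ 1 - (p : ℝ) := sub_nonneg.2 p.2.2
    have h1 := durationPoly_nonneg hu0 hv0 hw0 p r k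
    have h2 := durationPoly_nonneg hu0 hv0 hw0 p r (k + 1)
    have h3 := hu0 k
    have h4 := hv0 k
    have h5 := hw0 k
    rw [meanDuration_succ, ih k (by omega), ih (k + 1) (by omega), hu k (by omega),
      hv k (by omega), hw k (by omega), durationPoly,
      ENNReal.ofReal_add (by positivity) (by positivity),
      ENNReal.ofReal_add (by positivity) (by positivity),
      ENNReal.ofReal_mul (p := (p : ℝ) ^ 2) (by positivity),
      ENNReal.ofReal_mul (p := (p : ℝ) * (1 - p)) (by positivity), ENNReal.ofReal_mul hp0,
      ENNReal.ofReal_mul (p := (1 - (p : ℝ)) ^ 2) (by positivity),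
      ENNReal.ofReal_add (by positivity) h1, ENNReal.ofReal_add h5 h2,
      ENNReal.ofReal_mul (by norm_num), ENNReal.ofReal_pow p.2.1, ENNReal.ofReal_pow hp,
      ENNReal.ofReal_ofNat]

lemma inv_sq_mul_natCast (n : ℕ) :
    (1080⁻¹ : ℝ≥0∞) ^ 2 * n = ENNReal.ofReal (n / 1166400) := by
  rw [← ENNReal.toReal_eq_toReal_iff' (by finiteness) (by finiteness),
    ENNReal.toReal_ofReal (by positivity)]
  simp
  ring

/-- The probability that the players, with tours as in the improved strategy, do not meet during
their first `k` tours. -/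
noncomputable def improvedSurvival : ℕ → ℝ
  | 0 => 1
  | 1 => 1 / 2
  | 2 => 1 / 4
  | 3 => 1 / 8
  | 4 => 1001 / 16200
  | _ => 0

/-- The expectation of the duration of the tour number `k`, starting with number `0`, on the event
that the players did not meet before. -/
noncomputable def improvedDuration : ℕ → ℝ
  | 0 => 43 / 18
  | 1 => 43 / 36
  | 2 => 43 / 72
  | 3 => 14473 / 48600
  | _ => 0

/-- The expectation of the sum of the times at which the tours number `k` of the two players visit
the other player's home, on the event that the players did not meet before. -/
noncomputable def improvedVisit : ℕ → ℝ
  | 0 => 4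
  | 1 => 2
  | 2 => 1
  | 3 => 1 / 2
  | _ => 0

lemma tourExp_toursSurvival_zero (l : PMF (ℕ → Tour 3)) :
    tourExp l (toursSurvival 0) = ENNReal.ofReal (improvedSurvival 0) := by
  have : (toursSurvival 0 : (ℕ → Tour 3) → (ℕ → Tour 3) → ℝ≥0∞) = fun _ _ => 1 := by
    funext τ τ'
    simp [toursSurvival]
  simp [this, tourExp, PMF.lexp_const, improvedSurvival]

lemma tourExp_toursSurvival_one {l : PMF (ℕ → Tour 3)} (hl : UniformFirstTour l) :
    tourExp l (toursSurvival 1) = ENNReal.ofReal (improvedSurvival 1) := by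
  have h := tourExp_eq_pairSum1 hl hasTable_tStepSurvival
  rw [pairSum1_survivalTable, inv_sq_mul_natCast] at h
  convert h using 2
  · funext τ τ'
    simp [toursSurvival, cast_tStepSurvival]
  · norm_num [improvedSurvival]

lemma tourExp_duration_zero {l : PMF (ℕ → Tour 3)} (hl : UniformFirstTour l) :
    tourExp l (fun τ τ' => toursSurvival 0 τ τ' * tStepDuration (some (τ 0)) (some (τ' 0))) =
      ENNReal.ofReal (improvedDuration 0) := by
  have h := tourExp_eq_pairSum1 hl hasTable_tStepDuration
  rw [pairSum1_durationTable, inv_sq_mul_natCast] at h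
  convert h using 2
  · funext τ τ'
    simp [toursSurvival, cast_tStepDuration]
  · norm_num [improvedDuration]

lemma cast_visitDuration {R : Type*} [CommSemiring R] (τ τ' : Tour 3) :
    ((visitDuration τ τ' : ℕ) : R) = visitDuration τ τ' := by
  simp [visitDuration, cast_tStepDuration]

lemma tourExp_visit_zero {l : PMF (ℕ → Tour 3)} (hl : UniformFirstTour l) :
    tourExp l (fun τ τ' => toursSurvival 0 τ τ' * visitDuration (τ 0) (τ' 0)) =
      ENNReal.ofReal (improvedVisit 0) := by
  have h := tourExp_eq_pairSum1 hl
    hasTable_visitDuration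
  rw [pairSum1_visitTable, inv_sq_mul_natCast] at h
  convert h using 2
  · funext τ τ'
    simp [toursSurvival, cast_visitDuration]
  · norm_num [improvedVisit]

lemma tourExp_toursSurvival_improvedTours (k : ℕ) (hk : k ≤ 4) :
    tourExp improvedTours (toursSurvival k) = ENNReal.ofReal (improvedSurvival k) := by
  have h2 := tourExp_eq_pairSum2 hasTable_tStepSurvival hasTable_tStepSurvival
  have h3 := tourExp_eq_pairSum3 hasTable_tStepSurvival hasTable_tStepSurvival
    hasTable_tStepSurvival
  have h4 := tourExp_eq_pairSum4 hasTable_tStepSurvival hasTable_tStepSurvival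
    hasTable_tStepSurvival
    hasTable_tStepSurvival
  rw [pairSum2_survivalTable, inv_sq_mul_natCast] at h2
  rw [pairSum3_survivalTable, inv_sq_mul_natCast] at h3
  rw [pairSum4_survivalTable, inv_sq_mul_natCast] at h4
  interval_cases k
  · exact tourExp_toursSurvival_zero _
  · exact tourExp_toursSurvival_one uniformFirstTour_improvedTours
  · convert h2 using 2
    · funext τ τ'
      simp [toursSurvival, Finset.prod_range_succ, cast_tStepSurvival]
    · norm_num [improvedSurvival]
  · convert h3 using 2
    · funext τ τ'
      simp [toursSurvival, Finset.prod_range_succ, cast_tStepSurvival]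
    · norm_num [improvedSurvival]
  · convert h4 using 2
    · funext τ τ'
      simp [toursSurvival, Finset.prod_range_succ, cast_tStepSurvival]
    · norm_num [improvedSurvival]

lemma tourExp_duration_improvedTours (k : ℕ) (hk : k < 4) :
    tourExp improvedTours (fun τ τ' => toursSurvival k τ τ' *
      tStepDuration (some (τ k)) (some (τ' k))) = ENNReal.ofReal (improvedDuration k) := by
  have h2 := tourExp_eq_pairSum2 hasTable_tStepSurvival hasTable_tStepDuration
  have h3 := tourExp_eq_pairSum3 hasTable_tStepSurvival hasTable_tStepSurvival
    hasTable_tStepDuration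
  have h4 := tourExp_eq_pairSum4 hasTable_tStepSurvival hasTable_tStepSurvival
    hasTable_tStepSurvival
    hasTable_tStepDuration
  rw [pairSum2_durationTable, inv_sq_mul_natCast] at h2
  rw [pairSum3_durationTable, inv_sq_mul_natCast] at h3
  rw [pairSum4_durationTable, inv_sq_mul_natCast] at h4
  interval_cases k
  · exact tourExp_duration_zero uniformFirstTour_improvedTours
  · convert h2 using 2
    · funext τ τ'
      simp [toursSurvival, cast_tStepSurvival, cast_tStepDuration]
    · norm_num [improvedDuration]
  · convert h3 using 2
    · funext τ τ'
      simp [toursSurvival, Finset.prod_range_succ, cast_tStepSurvival, cast_tStepDuration]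
    · norm_num [improvedDuration]
  · convert h4 using 2
    · funext τ τ'
      simp [toursSurvival, Finset.prod_range_succ, cast_tStepSurvival, cast_tStepDuration]
    · norm_num [improvedDuration]

lemma tourExp_visit_improvedTours (k : ℕ) (hk : k < 4) :
    tourExp improvedTours (fun τ τ' => toursSurvival k τ τ' * visitDuration (τ k) (τ' k)) =
      ENNReal.ofReal (improvedVisit k) := by
  have h2 := tourExp_eq_pairSum2
    hasTable_tStepSurvival hasTable_visitDuration
  have h3 := tourExp_eq_pairSum3
    hasTable_tStepSurvival hasTable_tStepSurvival hasTable_visitDuration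
  have h4 := tourExp_eq_pairSum4
    hasTable_tStepSurvival hasTable_tStepSurvival hasTable_tStepSurvival hasTable_visitDuration
  rw [pairSum2_visitTable, inv_sq_mul_natCast] at h2
  rw [pairSum3_visitTable, inv_sq_mul_natCast] at h3
  rw [pairSum4_visitTable, inv_sq_mul_natCast] at h4
  interval_cases k
  · exact tourExp_visit_zero uniformFirstTour_improvedTours
  · convert h2 using 2
    · funext τ τ'
      simp [toursSurvival, cast_tStepSurvival, cast_visitDuration]
    · norm_num [improvedVisit]
  · convert h3 using 2
    · funext τ τ'
      simp [toursSurvival, Finset.prod_range_succ, cast_tStepSurvival, cast_visitDuration]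
    · norm_num [improvedVisit]
  · convert h4 using 2
    · funext τ τ'
      simp [toursSurvival, Finset.prod_range_succ, cast_tStepSurvival, cast_visitDuration]
    · norm_num [improvedVisit]

lemma improvedSurvival_nonneg (k : ℕ) : 0 ≤ improvedSurvival k := by
  unfold improvedSurvival
  split <;> norm_num

lemma improvedDuration_nonneg (k : ℕ) : 0 ≤ improvedDuration k := by
  unfold improvedDuration
  split <;> norm_num

lemma improvedVisit_nonneg (k : ℕ) : 0 ≤ improvedVisit k := by
  unfold improvedVisit
  split <;> norm_num

/-- The probability of not meeting during `r` t-steps of the improved strategy. -/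
noncomputable abbrev survivalValue (p : ℝ) (r : ℕ) : ℝ := survivalPoly improvedSurvival p r 0

/-- The expected number of steps of `r` t-steps of the improved strategy that are played. -/
noncomputable abbrev durationValue (p : ℝ) (r : ℕ) : ℝ :=
  durationPoly improvedSurvival improvedVisit improvedDuration p r 0

lemma expectedMeetingTime_improvedStrategy {h₁ h₂ : Fin 4} (hne : h₁ ≠ h₂) (p : unitInterval) :
    expectedMeetingTime (m := 3) h₁ h₂ (improvedStrategy p) =
      ENNReal.ofReal (durationValue p 4) * (1 - ENNReal.ofReal (survivalValue p 4))⁻¹ := by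
  rw [improvedStrategy, (hasTSteps_improvedBlock p).expectedMeetingTime_eq rfl
    lexp_improvedTours_mul hne,
    meanSurvival_eq_survivalPoly improvedSurvival_nonneg tourExp_toursSurvival_improvedTours
      p 4 0 le_rfl,
    meanDuration_eq_durationPoly improvedSurvival_nonneg improvedVisit_nonneg
      improvedDuration_nonneg (fun k hk => tourExp_toursSurvival_improvedTours k hk.le)
      tourExp_visit_improvedTours tourExp_duration_improvedTours p 4 0 le_rfl]

lemma expectedMeetingTime_andersonWeber {h₁ h₂ : Fin 4} (hne : h₁ ≠ h₂) (p : unitInterval) :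
    expectedMeetingTime (m := 3) h₁ h₂ (andersonWeber 3 p) =
      ENNReal.ofReal (durationValue p 1) * (1 - ENNReal.ofReal (survivalValue p 1))⁻¹ := by
  have hl := uniformFirstTour_andersonWeberTours
  rw [andersonWeber, (hasTSteps_awBlock p).expectedMeetingTime_eq rfl
    lexp_andersonWeberTours_mul hne,
    meanSurvival_eq_survivalPoly (n := 1) improvedSurvival_nonneg ?_ p 1 0 le_rfl,
    meanDuration_eq_durationPoly (n := 1) improvedSurvival_nonneg improvedVisit_nonneg
      improvedDuration_nonneg ?_ ?_ ?_ p 1 0 le_rfl]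
  · intro k hk
    obtain rfl : k = 0 := by omega
    exact tourExp_toursSurvival_zero _
  · intro k hk
    obtain rfl : k = 0 := by omega
    exact tourExp_visit_zero hl
  · intro k hk
    obtain rfl : k = 0 := by omega
    exact tourExp_duration_zero hl
  · intro k hk
    interval_cases k
    · exact tourExp_toursSurvival_zero _
    · exact tourExp_toursSurvival_one hl

lemma survivalValue_one (p : ℝ) : survivalValue p 1 = p ^ 2 + (1 - p) ^ 2 / 2 := by
  simp only [survivalValue, survivalPoly, improvedSurvival]
  ring

lemma durationValue_one (p : ℝ) :
    durationValue p 1 = 3 * p ^ 2 + 4 * (p * (1 - p)) + 43 / 18 * (1 - p) ^ 2 := by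
  simp only [durationValue, durationPoly, improvedSurvival, improvedVisit, improvedDuration]
  ring

lemma survivalValue_four (p : ℝ) : 16200 * (survivalValue p 4 - 1) =
    82001 * p ^ 8 - 218608 * p ^ 7 + 327728 * p ^ 6 - 315256 * p ^ 5 + 215870 * p ^ 4
      - 104656 * p ^ 3 + 36128 * p ^ 2 - 8008 * p - 15199 := by
  simp only [survivalValue, survivalPoly, improvedSurvival]
  ring

lemma durationValue_four (p : ℝ) : -48600 * durationValue p 4 =
    -227773 * p ^ 8 + 582884 * p ^ 7 - 1329319 * p ^ 6 + 1737938 * p ^ 5 - 1941235 * p ^ 4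
      + 1420688 * p ^ 3 - 998569 * p ^ 2 + 389834 * p - 217648 := by
  simp only [durationValue, durationPoly, improvedSurvival, improvedVisit, improvedDuration]
  ring

lemma survivalValue_one_lt_one {p : ℝ} (h0 : 0 ≤ p) (h1 : p < 1) : survivalValue p 1 < 1 := by
  have : 0 < (1 - p) * (1 + 3 * p) := mul_pos (sub_pos.2 h1) (by positivity)
  rw [survivalValue_one]
  linarith

lemma survivalValue_four_lt_one {p : ℝ} (h0 : 0 ≤ p) (h1 : p < 1) : survivalValue p 4 < 1 := by
  have h : survivalValue p 4 + 23 / 32400 * (1 - p) ^ 8 = survivalValue p 1 ^ 4 := by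
    rw [survivalValue_one]
    simp only [survivalValue, survivalPoly, improvedSurvival]
    ring
  have h' : survivalValue p 1 ^ 4 < 1 :=
    pow_lt_one₀ (survivalPoly_nonneg improvedSurvival_nonneg p 1 0)
      (survivalValue_one_lt_one h0 h1) (by norm_num)
  have : 0 ≤ (1 - p) ^ 8 := pow_nonneg (sub_pos.2 h1).le 8
  linarith

lemma ofReal_mul_inv_one_sub_ofReal {d s : ℝ} (hs0 : 0 ≤ s) (hs : s < 1) :
    ENNReal.ofReal d * (1 - ENNReal.ofReal s)⁻¹ = ENNReal.ofReal (d / (1 - s)) := by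
  rw [← ENNReal.ofReal_one, ← ENNReal.ofReal_sub 1 hs0,
    ENNReal.ofReal_div_of_pos (sub_pos.2 hs), div_eq_mul_inv]

/-- The expected meeting time of the improved strategy. -/
noncomputable def improvedValue (p : ℝ) : ℝ :=
  (-227773 * p ^ 8 + 582884 * p ^ 7 - 1329319 * p ^ 6 + 1737938 * p ^ 5 - 1941235 * p ^ 4
    + 1420688 * p ^ 3 - 998569 * p ^ 2 + 389834 * p - 217648) /
  (3 * (82001 * p ^ 8 - 218608 * p ^ 7 + 327728 * p ^ 6 - 315256 * p ^ 5 + 215870 * p ^ 4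
    - 104656 * p ^ 3 + 36128 * p ^ 2 - 8008 * p - 15199))

/-- The expected meeting time of the Anderson–Weber strategy on `K₄`. -/
noncomputable def andersonWeberValue (p : ℝ) : ℝ :=
  (43 - 14 * p + 25 * p ^ 2) / (9 * (1 + 2 * p - 3 * p ^ 2))

lemma durationValue_div_four {p : ℝ} (h0 : 0 ≤ p) (h1 : p < 1) :
    durationValue p 4 / (1 - survivalValue p 4) = improvedValue p := by
  have := sub_pos.2 (survivalValue_four_lt_one h0 h1)
  have h' : survivalValue p 4 - 1 ≠ 0 := by linarith
  rw [improvedValue, ← survivalValue_four, ← durationValue_four]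
  rw [div_eq_div_iff this.ne' (mul_ne_zero (by norm_num) (mul_ne_zero (by norm_num) h'))]
  ring

lemma durationValue_div_one {p : ℝ} (h0 : 0 ≤ p) (h1 : p < 1) :
    durationValue p 1 / (1 - survivalValue p 1) = andersonWeberValue p := by
  have h2 : 0 < 1 - survivalValue p 1 := sub_pos.2 (survivalValue_one_lt_one h0 h1)
  rw [survivalValue_one] at *
  have h3 : 0 < 1 + 2 * p - 3 * p ^ 2 := by linarith
  rw [andersonWeberValue, durationValue_one, div_eq_div_iff h2.ne' (by positivity)]
  ring

section

variable {h₁ h₂ : Fin 4}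

lemma expectedMeetingTime_improvedStrategy_of_lt (hne : h₁ ≠ h₂) {p : unitInterval} (hp : p < 1) :
    expectedMeetingTime (m := 3) h₁ h₂ (improvedStrategy p) = ENNReal.ofReal (improvedValue p) := by
  rw [expectedMeetingTime_improvedStrategy hne, ofReal_mul_inv_one_sub_ofReal
    (survivalPoly_nonneg improvedSurvival_nonneg p 4 0) (survivalValue_four_lt_one p.2.1 hp),
    durationValue_div_four p.2.1 hp]

lemma expectedMeetingTime_andersonWeber_of_lt (hne : h₁ ≠ h₂) {p : unitInterval} (hp : p < 1) :
    expectedMeetingTime (m := 3) h₁ h₂ (andersonWeber 3 p) =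
      ENNReal.ofReal (andersonWeberValue p) := by
  rw [expectedMeetingTime_andersonWeber hne, ofReal_mul_inv_one_sub_ofReal
    (survivalPoly_nonneg improvedSurvival_nonneg p 1 0) (survivalValue_one_lt_one p.2.1 hp),
    durationValue_div_one p.2.1 hp]

lemma expectedMeetingTime_andersonWeber_one (hne : h₁ ≠ h₂) :
    expectedMeetingTime (m := 3) h₁ h₂ (andersonWeber 3 1) = ⊤ := by
  rw [expectedMeetingTime_andersonWeber hne, survivalValue_one, durationValue_one]
  simp

end

lemma sq_sqrt_681 : √681 ^ 2 = (681 : ℝ) := Real.sq_sqrt (by norm_num)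

lemma sqrt_681_mem_Ioo : √681 ∈ Set.Ioo (26.095976 : ℝ) 26.095977 :=
  ⟨Real.lt_sqrt_of_sq_lt (by norm_num), (Real.sqrt_lt' (by norm_num)).2 (by norm_num)⟩

/-- The staying probability of the best Anderson–Weber strategy on `K₄`. -/
noncomputable def bestStay : ℝ := (3 * √681 - 77) / 4

lemma bestStay_mem_Ico : bestStay ∈ Set.Ico (0 : ℝ) 1 := by
  have := sqrt_681_mem_Ioo.1
  have := sqrt_681_mem_Ioo.2
  constructor <;> unfold bestStay <;> linarith

lemma le_andersonWeberValue {p : ℝ} (h0 : 0 ≤ p) (h1 : p < 1) :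
    (15 + √681) / 12 ≤ andersonWeberValue p := by
  have h : 0 < (1 - p) * (1 + 3 * p) := mul_pos (sub_pos.2 h1) (by positivity)
  have h' : 0 < 1 + 2 * p - 3 * p ^ 2 := by linarith
  rw [andersonWeberValue, div_le_div_iff₀ (by norm_num) (by positivity)]
  have h2 := mul_nonneg (by positivity : 0 ≤ 705 + 27 * √681) (sq_nonneg (p - bestStay))
  unfold bestStay at h2
  linear_combination h2 + (-81 / 2 * p + (243 * √681 - 6129) / 16) * sq_sqrt_681

lemma andersonWeberValue_bestStay : andersonWeberValue bestStay = (15 + √681) / 12 := by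
  have h0 := bestStay_mem_Ico.1
  have h1 := bestStay_mem_Ico.2
  have h : 0 < (1 - bestStay) * (1 + 3 * bestStay) := mul_pos (sub_pos.2 h1) (by positivity)
  have h' : 0 < 1 + 2 * bestStay - 3 * bestStay ^ 2 := by linarith
  rw [andersonWeberValue, div_eq_div_iff (by positivity) (by norm_num)]
  unfold bestStay
  linear_combination (243 * √681 - 6345) / 16 * sq_sqrt_681

lemma improvedValue_bestStay : improvedValue bestStay +
    243 * (75041961207 + 4700853101 * √681) / 327540887401488016 = (15 + √681) / 12 := by
  have hD : 82001 * bestStay ^ 8 - 218608 * bestStay ^ 7 + 327728 * bestStay ^ 6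
      - 315256 * bestStay ^ 5 + 215870 * bestStay ^ 4 - 104656 * bestStay ^ 3
      + 36128 * bestStay ^ 2 - 8008 * bestStay - 15199 ≠ 0 := by
    rw [← survivalValue_four]
    have := survivalValue_four_lt_one bestStay_mem_Ico.1 bestStay_mem_Ico.2
    exact mul_ne_zero (by norm_num) (sub_ne_zero.2 this.ne)
  have h1 : bestStay = -77 / 4 + 3 / 4 * √681 := by
    unfold bestStay
    ring
  have h2 : bestStay ^ 2 = 6029 / 8 - 231 / 8 * √681 := by
    linear_combination bestStay * h1 + (-77 / 4 + 3 / 4 * √681) * h1 + 9 / 16 * sq_sqrt_681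
  have h3 : bestStay ^ 3 = -468083 / 16 + 17937 / 16 * √681 := by
    linear_combination bestStay * h2 + (6029 / 8 - 231 / 8 * √681) * h1 + (-693 / 32) * sq_sqrt_681
  have h4 : bestStay ^ 4 = 36343841 / 32 - 1392699 / 32 * √681 := by
    linear_combination bestStay * h3 +
      (-468083 / 16 + 17937 / 16 * √681) * h1 +
      53811 / 64 * sq_sqrt_681
  have h5 : bestStay ^ 5 = -2821879907 / 64 + 108134673 / 64 * √681 := by
    linear_combination bestStay * h4 +
      (36343841 / 32 - 1392699 / 32 * √681) * h1 +
      (-4178097 / 128) * sq_sqrt_681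
  have h6 : bestStay ^ 6 = 219101944889 / 128 - 8396004771 / 128 * √681 := by
    linear_combination bestStay * h5 +
      (-2821879907 / 64 + 108134673 / 64 * √681) * h1 +
      324404019 / 256 * sq_sqrt_681
  have h7 : bestStay ^ 7 = -17011943751803 / 256 + 651899101017 / 256 * √681 := by
    linear_combination bestStay * h6 +
      (219101944889 / 128 - 8396004771 / 128 * √681) * h1 +
      (-25188014313 / 512) * sq_sqrt_681
  have h8 : bestStay ^ 8 = 1320874766133281 / 512 - 50616031016859 / 512 * √681 := by
    linear_combination bestStay * h7 +
      (-17011943751803 / 256 + 651899101017 / 256 * √681) * h1 +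
      1955697303051 / 1024 * sq_sqrt_681
  have hN : -227773 * bestStay ^ 8 + 582884 * bestStay ^ 7 - 1329319 * bestStay ^ 6
      + 1737938 * bestStay ^ 5 - 1941235 * bestStay ^ 4 + 1420688 * bestStay ^ 3
      - 998569 * bestStay ^ 2 + 389834 * bestStay - 217648 =
      -321896997782047042641 / 512 + 12335119756782142635 / 512 * √681 := by
    rw [h8, h7, h6, h5, h4, h3, h2]
    linear_combination 389834 * h1
  have hD' : 82001 * bestStay ^ 8 - 218608 * bestStay ^ 7 + 327728 * bestStay ^ 6
      - 315256 * bestStay ^ 5 + 215870 * bestStay ^ 4 - 104656 * bestStay ^ 3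
      + 36128 * bestStay ^ 2 - 8008 * bestStay - 15199 =
      116045413092774373617 / 512 - 4446869891884825995 / 512 * √681 := by
    rw [h8, h7, h6, h5, h4, h3, h2]
    linear_combination -8008 * h1
  rw [hD'] at hD
  rw [improvedValue, hN, hD', div_add' _ _ _ (mul_ne_zero (by norm_num) hD),
    div_eq_iff (mul_ne_zero (by norm_num) hD)]
  linear_combination (364117688560862528113921914953443125 / 167700934349561864192) * sq_sqrt_681

lemma abs_gain_sub_lt : |243 * (75041961207 + 4700853101 * √681) / 327540887401488016
    - (0.000146683 : ℝ)| < (5e-10 : ℝ) := by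
  have := sqrt_681_mem_Ioo.1
  have := sqrt_681_mem_Ioo.2
  norm_num at *
  rw [abs_lt]
  constructor <;> linarith

theorem mainTheorem1 (h₁ h₂ : Fin 4) (hne : h₁ ≠ h₂) :
    -- the improved strategy is 12-Markov, and its expected meeting time is a rational function
    (∀ p : unitInterval, IsMarkov (m := 3) 12 (improvedStrategy p)) ∧
    (∀ p : unitInterval, p < 1 → expectedMeetingTime (m := 3) h₁ h₂ (improvedStrategy p) =
      ENNReal.ofReal
        ((-227773 * (p : ℝ) ^ 8 + 582884 * (p : ℝ) ^ 7 - 1329319 * (p : ℝ) ^ 6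
            + 1737938 * (p : ℝ) ^ 5 - 1941235 * (p : ℝ) ^ 4 + 1420688 * (p : ℝ) ^ 3
            - 998569 * (p : ℝ) ^ 2 + 389834 * (p : ℝ) - 217648) /
          (3 * (82001 * (p : ℝ) ^ 8 - 218608 * (p : ℝ) ^ 7 + 327728 * (p : ℝ) ^ 6
            - 315256 * (p : ℝ) ^ 5 + 215870 * (p : ℝ) ^ 4 - 104656 * (p : ℝ) ^ 3
            + 36128 * (p : ℝ) ^ 2 - 8008 * (p : ℝ) - 15199)))) ∧
    -- the expected meeting time of the Anderson–Weber strategy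
    (∀ p : unitInterval, p < 1 → expectedMeetingTime (m := 3) h₁ h₂ (andersonWeber 3 p) =
      ENNReal.ofReal ((43 - 14 * (p : ℝ) + 25 * (p : ℝ) ^ 2) /
        (9 * (1 + 2 * (p : ℝ) - 3 * (p : ℝ) ^ 2)))) ∧
    -- comparison at the optimal Anderson–Weber parameter
    (∃ p₀ : unitInterval, (p₀ : ℝ) = (3 * √681 - 77) / 4 ∧
      expectedMeetingTime (m := 3) h₁ h₂ (andersonWeber 3 p₀) =
        ENNReal.ofReal ((15 + √681) / 12) ∧
      (∀ p : unitInterval, expectedMeetingTime (m := 3) h₁ h₂ (andersonWeber 3 p₀) ≤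
        expectedMeetingTime (m := 3) h₁ h₂ (andersonWeber 3 p)) ∧
      expectedMeetingTime (m := 3) h₁ h₂ (improvedStrategy p₀) +
          ENNReal.ofReal (243 * (75041961207 + 4700853101 * √681) / 327540887401488016) =
        expectedMeetingTime (m := 3) h₁ h₂ (andersonWeber 3 p₀) ∧
      |243 * (75041961207 + 4700853101 * √681) / 327540887401488016 - (0.000146683 : ℝ)| <
        (5e-10 : ℝ) ∧
      (∀ p : unitInterval, expectedMeetingTime (m := 3) h₁ h₂ (improvedStrategy p₀) <
        expectedMeetingTime (m := 3) h₁ h₂ (andersonWeber 3 p))) ∧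
    -- no Anderson–Weber strategy is optimal
    (∀ p : unitInterval, ¬ IsOptimal (m := 3) h₁ h₂ (andersonWeber 3 p)) := by
  set p₀ : unitInterval := ⟨bestStay, bestStay_mem_Ico.1, bestStay_mem_Ico.2.le⟩
  have hp₀ : p₀ < 1 := bestStay_mem_Ico.2
  have hbest : expectedMeetingTime (m := 3) h₁ h₂ (andersonWeber 3 p₀) =
      ENNReal.ofReal ((15 + √681) / 12) := by
    rw [expectedMeetingTime_andersonWeber_of_lt hne hp₀, ← andersonWeberValue_bestStay]
  have hmin (p : unitInterval) : expectedMeetingTime (m := 3) h₁ h₂ (andersonWeber 3 p₀) ≤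
      expectedMeetingTime (m := 3) h₁ h₂ (andersonWeber 3 p) := by
    rcases eq_or_ne p 1 with rfl | hp
    · rw [expectedMeetingTime_andersonWeber_one hne]
      exact le_top
    · have hp1 : p < 1 := lt_of_le_of_ne p.2.2 hp
      rw [hbest, expectedMeetingTime_andersonWeber_of_lt hne hp1]
      exact ENNReal.ofReal_le_ofReal (le_andersonWeberValue p.2.1 hp1)
  have hgain : expectedMeetingTime (m := 3) h₁ h₂ (improvedStrategy p₀) +
      ENNReal.ofReal (243 * (75041961207 + 4700853101 * √681) / 327540887401488016) =
      expectedMeetingTime (m := 3) h₁ h₂ (andersonWeber 3 p₀) := by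
    rw [hbest, expectedMeetingTime_improvedStrategy_of_lt hne hp₀, ← improvedValue_bestStay,
      ENNReal.ofReal_add _ (by positivity)]
    change 0 ≤ improvedValue p₀
    rw [← durationValue_div_four p₀.2.1 hp₀]
    exact div_nonneg (durationPoly_nonneg improvedSurvival_nonneg improvedVisit_nonneg
      improvedDuration_nonneg p₀ 4 0) (sub_pos.2 (survivalValue_four_lt_one p₀.2.1 hp₀)).le
  have hlt (p : unitInterval) : expectedMeetingTime (m := 3) h₁ h₂ (improvedStrategy p₀) <
      expectedMeetingTime (m := 3) h₁ h₂ (andersonWeber 3 p) := by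
    refine lt_of_lt_of_le ?_ (hmin p)
    rw [← hgain]
    refine ENNReal.lt_add_right ?_ (ENNReal.ofReal_pos.2 (by positivity)).ne'
    rw [expectedMeetingTime_improvedStrategy_of_lt hne hp₀]
    exact ENNReal.ofReal_ne_top
  refine ⟨fun p => ⟨improvedBlock p, rfl⟩,
    fun p hp => expectedMeetingTime_improvedStrategy_of_lt hne hp,
    fun p hp => expectedMeetingTime_andersonWeber_of_lt hne hp,
    ⟨p₀, rfl, hbest, hmin, hgain, abs_gain_sub_lt, hlt⟩, fun p hopt => ?_⟩
  have : IsProbabilityMeasure (improvedStrategy p₀) := by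
    unfold improvedStrategy
    infer_instance
  exact (hlt p).not_ge (hopt _ this)
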